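/- **Setting.** Let $H_1,\dots,H_d$ be null hypotheses with real test statistics $X_1,\dots,X_d$ on a probability space, let $\mathcal F$ be the set of false hypotheses and $\mathcal T$ its complement, the set of true ones. The raw $p$-values are $p_i=2(1-\Phi(|X_i|))$, where $\Phi$ is the standard normal distribution function. Order them as $p_{(1)}\le\dots\le p_{(d)}$ (ties broken by the index), with corresponding hypotheses $H_{(1)},\dots,H_{(d)}$. The sequential Cauchy combination (SCC) procedure computes, for $i=1,\dots,d$, $$\tilde T_{(i)}=\sum_{j=i}^{d}\tfrac1d\tan\{(\tfrac12-p_{(j)})\pi\},\qquad \tilde p_{(i)}=\tfrac12-\tfrac{\arctan \tilde T_{(i)}}{\pi},$$ where $\tilde p_{(i)}$ tests the intersection $\mathcal H_0^{(i)}=\bigcap_{j\ge i}H_{(j)}$. With $\mathcal R^{(0)}=\varnothing$, for $s=0,\dots,d-1$ let $\mathcal N_s=\{H_{(d-s)}:\tilde p_{(d-s)}\le\alpha\}$ be the hypotheses newly rejected in step $s+1$ and $\mathcal R^{(s+1)}=\mathcal R^{(s)}\cup\mathcal N_s$. As a function of an arbitrary set $R$ of hypotheses, the successor $\mathcal N(R)$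 consists of the hypothesis outside $R$ with the smallest raw $p$-value if its SCC $p$-value is at most $\alpha$, and is empty otherwise. **Assumption 1.** Every pair $(X_i,X_j)$, $i<j$, is bivariate normal (possibly degenerate); each $X_i$ is normal with variance $1$; and $E X_i=0$ for every true $H_i$. **Assumption 2.** The correlation matrix $\Sigma=(\sigma_{ij})$ of $(X_1,\dots,X_d)$ satisfies $\lambda_{\max}(\Sigma)\le C_0$ and $\max_{i<j}\sigma_{ij}^2\le\sigma_{\max}^2$, with constants $C_0>0$ and $0<\sigma_{\max}^2<1$. **Theorem.** Consider either of two cases. (a) $d$ and the law of $(X_1,\dots,X_d)$ are fixed, Assumption 1 holds, and $\alpha\downarrow0$. (b) $\alpha=\alpha_n\downarrow0$ and $d=d_n\to\infty$ with $d_n=o(h_n^{\eta})$ for some $0<\eta<\frac12$, where $h_n=\tan\{(\frac12-\alpha_n)\pi\}$. The statistics (and the set $\mathcal F$) may change with $n$. Assumptions 1 and 2 hold for every $n$, with $C_0$ and $\sigma_{\max}^2$ not depending on $n$, and the means of the statistics of the false hypotheses are bounded in absolute value by a constant not depending on $n$ (for example, all means are zero). Then the following hold. 1. (Monotonicity.)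 For every real $\alpha$: almost surely, $\mathcal R^{(s)}\subseteq\mathcal R^{(l)}$ and $\mathcal N_s\subseteq\mathcal N_l\cup\mathcal R^{(l)}$ for all $0\le s\le l<d$. Moreover, for all sets of hypotheses $R\subseteq S$, almost surely $\mathcal N(R)\subseteq\mathcal N(S)\cup S$. If $\alpha\le\frac12$, then almost surely iterating $R\mapsto R\cup\mathcal N(R)$ $d$ times from $\varnothing$ gives $\mathcal R^{(d)}$. 2. (Single-step condition, in the limit.) For every $\varepsilon>0$, for all sufficiently small $\alpha$ in case (a), and with $\alpha=\alpha_n$ for all sufficiently large $n$ in case (b), the combination $p$-value $\tilde p_{\mathcal T}=\frac12-\frac1\pi\arctan\big(\sum_{j\in\mathcal T}\frac1d\tan\{(\frac12-p_j)\pi\}\big)$ of the intersection of all true hypotheses (which equals $\tilde p_{(i)}$ when $\mathcal H_0^{(i)}=\mathcal T$) satisfies $$\Pr(\tilde p_{\mathcal T}\le\alpha)\le(1+\varepsilon)\alpha,\qquad\text{and}\qquad \Pr(\mathcal N(\mathcal F)\subseteq\mathcal F)\ge 1-(1+\varepsilon)\alpha .$$ 3. (Strong familywise error control, in the limit.) For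 every $\varepsilon>0$, in the same sense, $$\Pr(\mathcal R^{(d)}\subseteq\mathcal F)\ge 1-(1+\varepsilon)\alpha ,$$ that is, $\limsup \Pr(\mathcal R^{(d)}\not\subseteq\mathcal F)/\alpha\le 1$. -/

import Mathlib

open MeasureTheory ProbabilityTheory Filter Topology Asymptotics

noncomputable section

namespace SCC

/-! ### The sequential Cauchy combination procedure

Hypotheses are indexed by `Fin d`. Ranks are elements of `Fin d` as well, so rank `k` here is the
rank `k + 1` of the usual notation `p_(1) ≤ ... ≤ p_(d)`. -/

/-- Two-sided raw `p`-value `2 (1 - Φ(|x|))` of a standardized test statistic. -/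
def rawPval (x : ℝ) : ℝ := 2 * (1 - cdf (gaussianReal 0 1) |x|)

/-- The standard Cauchy variate attached to a `p`-value. -/
def cauchyVariate (p : ℝ) : ℝ := Real.tan ((1 / 2 - p) * Real.pi)

/-- Upper tail probability of the standard Cauchy distribution at `t`. -/
def cauchyPval (t : ℝ) : ℝ := 1 / 2 - Real.arctan t / Real.pi

variable {d : ℕ}

/-- The hypothesis `H_(k)`, i.e. the one with the `k`-th smallest raw `p`-value
(ties are broken by the index). -/
def ranked (p : Fin d → ℝ) (k : Fin d) : Fin d := Tuple.sort p k

/-- SCC statistic of rank `k`: the sum over the ranks `j ≥ k` with weights `1 / d`. -/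
def sccStat (p : Fin d → ℝ) (k : Fin d) : ℝ :=
  ∑ j ∈ Finset.Ici k, (1 / (d : ℝ)) * cauchyVariate (p (ranked p j))

/-- SCC `p`-value of rank `k`. -/
def sccPval (p : Fin d → ℝ) (k : Fin d) : ℝ := cauchyPval (sccStat p k)

/-- The hypotheses whose intersection is tested at rank `k`: `H_(j)` for `j ≥ k`. -/
def nullFrom (p : Fin d → ℝ) (k : Fin d) : Finset (Fin d) := (Finset.Ici k).image (ranked p)

/-- Cauchy combination `p`-value (weights `1 / d`) of the intersection of the hypotheses in `S`. -/
def combPval (p : Fin d → ℝ) (S : Finset (Fin d)) : ℝ :=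
  cauchyPval (∑ j ∈ S, (1 / (d : ℝ)) * cauchyVariate (p j))

/-- The SCC `p`-value of rank `k` is the combination `p`-value of the intersection hypothesis
that is tested at that rank. -/
theorem sccPval_eq_combPval (p : Fin d → ℝ) (k : Fin d) :
    sccPval p k = combPval p (nullFrom p k) := by
  unfold sccPval combPval sccStat nullFrom
  rw [Finset.sum_image]
  intro a _ b _ h
  exact (Tuple.sort p).injective h

/-- The hypotheses newly rejected in step `s + 1`: the hypothesis `H_(d-s)` (1-based rank), if its
SCC `p`-value is at most `α`. -/
def stepNext (α : ℝ) (p : Fin d → ℝ) (s : ℕ) : Finset (Fin d) :=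
  (Finset.univ.filter fun k : Fin d => (k : ℕ) + 1 + s = d ∧ sccPval p k ≤ α).image (ranked p)

/-- The rejected set `R^(s)` after step `s`; the final rejection set is `R^(d)`. -/
def rejected (α : ℝ) (p : Fin d → ℝ) : ℕ → Finset (Fin d)
  | 0 => ∅
  | s + 1 => rejected α p s ∪ stepNext α p s

/-- The successor function on arbitrary sets of hypotheses: given that the
hypotheses in `R` are rejected, the next candidate is the hypothesis outside `R` with the smallest
raw `p`-value; it is rejected if its SCC `p`-value is at most `α`. -/
def successor (α : ℝ) (p : Fin d → ℝ) (R : Finset (Fin d)) : Finset (Fin d) :=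
  (Finset.univ.filter fun k : Fin d =>
    ranked p k ∉ R ∧ (∀ j < k, ranked p j ∈ R) ∧ sccPval p k ≤ α).image (ranked p)

/-- The sequential rejection procedure generated by a successor function `N`. -/
def iterate (N : Finset (Fin d) → Finset (Fin d)) : ℕ → Finset (Fin d)
  | 0 => ∅
  | s + 1 => iterate N s ∪ N (iterate N s)

variable {Ω : Type*} [MeasurableSpace Ω]

/-- The vector of raw `p`-values. -/
def pvals (X : Fin d → Ω → ℝ) (ω : Ω) : Fin d → ℝ := fun i => rawPval (X i ω)

/-- Monotonicity of the SCC procedure at level `α`: for the rejected sets along the steps of the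
procedure, for the successor function on all sets of hypotheses, and the fact that the
latter generates the final rejection set. -/
structure Monotonicity (P : Measure Ω) (X : Fin d → Ω → ℝ) (α : ℝ) : Prop where
  step : ∀ s l : ℕ, s ≤ l → l < d → ∀ᵐ ω ∂P,
    rejected α (pvals X ω) s ⊆ rejected α (pvals X ω) l ∧
      stepNext α (pvals X ω) s ⊆ stepNext α (pvals X ω) l ∪ rejected α (pvals X ω) l
  sets : ∀ R S : Finset (Fin d), R ⊆ S → ∀ᵐ ω ∂P,
    successor α (pvals X ω) R ⊆ successor α (pvals X ω) S ∪ S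
  generates : α ≤ 1 / 2 → ∀ᵐ ω ∂P,
    iterate (successor α (pvals X ω)) d = rejected α (pvals X ω) d

/-! ### Assumptions on the test statistics -/

/-- The test statistics are standardized and pairwise bivariate normal, and those of the true
hypotheses (the ones outside `F`) have mean zero. -/
structure PairwiseNormal (P : Measure Ω) (X : Fin d → Ω → ℝ) (F : Finset (Fin d)) : Prop where
  bivariate : ∀ i j : Fin d, i < j → HasGaussianLaw (fun ω => (X i ω, X j ω)) P
  standardized : ∀ i : Fin d, HasLaw (X i) (gaussianReal (∫ ω, X i ω ∂P) 1) P
  mean_zero : ∀ i : Fin d, i ∉ F → ∫ ω, X i ω ∂P = 0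

/-- The correlation matrix of the test statistics. -/
def corrMatrix (P : Measure Ω) (X : Fin d → Ω → ℝ) : Matrix (Fin d) (Fin d) ℝ :=
  Matrix.of fun i j =>
    covariance (X i) (X j) P / (Real.sqrt (variance (X i) P) * Real.sqrt (variance (X j) P))

/-- The eigenvalues of the correlation matrix are at most `C₀` and the squared correlations of
distinct test statistics are at most `σsq`. -/
structure WeakCorrelation (P : Measure Ω) (X : Fin d → Ω → ℝ) (C₀ σsq : ℝ) : Prop where
  eigenvalue_le : ∀ lam : ℝ,
    Module.End.HasEigenvalue (Matrix.toLin' (corrMatrix P X)) lam → lam ≤ C₀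
  corr_sq_le : ∀ i j : Fin d, i < j → corrMatrix P X i j ^ 2 ≤ σsq

/-- The error bounds at level `α` with slack factor `1 + ε`. -/
structure ErrorBounds (P : Measure Ω) (X : Fin d → Ω → ℝ) (F : Finset (Fin d)) (α ε : ℝ) :
    Prop where
  /-- The Cauchy combination test of the intersection of all true hypotheses. -/
  critical : P.real {ω | combPval (pvals X ω) Fᶜ ≤ α} ≤ (1 + ε) * α
  /-- The single-step condition in terms of the successor function. -/
  single_step : 1 - (1 + ε) * α ≤ P.real {ω | successor α (pvals X ω) F ⊆ F}
  /-- Strong familywise error control. -/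
  fwer : 1 - (1 + ε) * α ≤ P.real {ω | rejected α (pvals X ω) d ⊆ F}

end SCC

end

namespace SCC

/-! ### Tails of the standard normal distribution and raw `p`-values -/

/-! Monotonicity is combinatorial: `mem_rejected` and `mem_iterate_successor` describe both
constructions by ranks, and for `α ≤ 1 / 2` the ranks passing the test form an initial segment.

For the error bounds, write `Y_j` for the Cauchy variates and `h = cauchyVariate α`, which is
asymptotic to `1 / (π α)`. Every error forces one event, `Offending`: some set `S` has `∑_{j ∈ S}
Y_j ≥ d h` and its smallest `p`-value belongs to a true hypothesis `k`. No union over steps of the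
procedure is needed.

A heavy-tailed sum is large because of a single term. Up to a null set, either the hypotheses
sharing the `p`-value of `k` contribute `(1 - δ) d h`, or the others in `S` contribute `δ d h`
(`Residual`). In the first case a class of size `m` costs at most `m / (π (1 - δ) d h)`; class sizes
add up to at most `d`, so the total is about `α` (`measureReal_class_le`).

In the residual case some `j` outside the class has a `p`-value of order at most `1 / h`, and so has
`k`, whose `p`-value is smaller still. For correlation at most `r < 1` in absolute value,
`exists_joint_tail` gives this probability `O(h ^ (-β))` with `β > 1`, which is `o(α)`. For fixed
`d` there are finitely many pairs; correlation `± 1` with a shifted mean is excluded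
deterministically by `eventually_not_of_shift`. For growing `d` the eigenvalue bound leaves
boundedly many strongly correlated partners per hypothesis, and one of these must have a variate of
order `d h`; the remaining `d²` pairs have a joint tail exponent close to `2`, which beats `d² ≤ h ^
(2 η)`. -/

lemma rawPval_eq_measureReal (x : ℝ) :
    rawPval x = 2 * (gaussianReal 0 1).real (Set.Ioi |x|) := by
  rw [rawPval, cdf_eq_real, ← Set.compl_Iic, probReal_compl_eq_one_sub measurableSet_Iic]

instance : NullSingletonClass (gaussianReal 0 1) := nullSingletonClass_gaussianReal one_ne_zero

lemma gaussianReal_real_Iio_neg (a : ℝ) :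
    (gaussianReal 0 1).real (Set.Iio (-a)) = (gaussianReal 0 1).real (Set.Ioi a) := by
  have h : (gaussianReal 0 1).map (fun x => -x) = gaussianReal 0 1 := by
    rw [gaussianReal_map_neg, neg_zero]
  conv_lhs => rw [← h]
  rw [map_measureReal_apply measurable_neg measurableSet_Iio]
  congr 1
  ext x
  simp

lemma rawPval_zero : rawPval 0 = 1 := by
  have h1 := gaussianReal_real_Iio_neg 0
  have h2 := probReal_compl_eq_one_sub (μ := gaussianReal 0 1) (measurableSet_Iic (a := (0 : ℝ)))
  rw [Set.compl_Iic] at h2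
  have h3 : (gaussianReal 0 1).real (Set.Iio 0) = (gaussianReal 0 1).real (Set.Iic 0) :=
    measureReal_congr Iio_ae_eq_Iic
  rw [rawPval_eq_measureReal, abs_zero]
  rw [neg_zero] at h1
  linarith

/-- The standard normal distribution gives mass at least `s φ(a + s)` to `(a, a + s]`. -/
lemma gaussianReal_real_Ioc_ge {a s : ℝ} (ha : 0 ≤ a) (hs : 0 ≤ s) :
    s * ((√(2 * Real.pi))⁻¹ * Real.exp (-(a + s) ^ 2 / 2)) ≤
      (gaussianReal 0 1).real (Set.Ioc a (a + s)) := by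
  rw [Measure.real, gaussianReal_apply_eq_integral 0 one_ne_zero, ENNReal.toReal_ofReal
    (setIntegral_nonneg measurableSet_Ioc fun x _ => gaussianPDFReal_nonneg _ _ _)]
  have h1 : ∫ _ in Set.Ioc a (a + s), ((√(2 * Real.pi))⁻¹ * Real.exp (-(a + s) ^ 2 / 2)) =
      s * ((√(2 * Real.pi))⁻¹ * Real.exp (-(a + s) ^ 2 / 2)) := by
    simp [hs]
  rw [← h1]
  refine setIntegral_mono_on (integrableOn_const (by simp)) (integrable_gaussianPDFReal 0 1).integrableOn
    measurableSet_Ioc fun x hx => ?_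
  have : x ^ 2 ≤ (a + s) ^ 2 := pow_le_pow_left₀ (ha.trans hx.1.le) hx.2 2
  simp only [gaussianPDFReal, NNReal.coe_one, mul_one, sub_zero]
  gcongr

lemma rawPval_lt_of_abs_lt {x y : ℝ} (h : |x| < |y|) : rawPval y < rawPval x := by
  rw [rawPval_eq_measureReal, rawPval_eq_measureReal]
  have h1 := gaussianReal_real_Ioc_ge (abs_nonneg x) (sub_nonneg.2 h.le)
  have h2 : 0 < (|y| - |x|) * ((√(2 * Real.pi))⁻¹ *
      Real.exp (-(|x| + (|y| - |x|)) ^ 2 / 2)) := by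
    have := sub_pos.2 h
    positivity
  rw [add_sub_cancel] at h1 h2
  have h3 : (gaussianReal 0 1).real (Set.Ioi |x|) =
      (gaussianReal 0 1).real (Set.Ioc |x| |y|) + (gaussianReal 0 1).real (Set.Ioi |y|) := by
    rw [← Set.Ioc_union_Ioi_eq_Ioi h.le, measureReal_union _ measurableSet_Ioi]
    rw [Set.disjoint_left]
    intro z hz hz'
    exact absurd hz.2 (not_le.2 hz')
  linarith

lemma abs_le_of_rawPval_le {x y : ℝ} (h : rawPval y ≤ rawPval x) : |x| ≤ |y| := by
  by_contra! hc
  exact absurd (rawPval_lt_of_abs_lt hc) (not_lt.2 h)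

lemma rawPval_lt_one {x : ℝ} (hx : x ≠ 0) : rawPval x < 1 := by
  rw [← rawPval_zero]
  exact rawPval_lt_of_abs_lt (by simpa using hx)

lemma rawPval_ge (x : ℝ) {s : ℝ} (hs : 0 ≤ s) :
    2 * (s * ((√(2 * Real.pi))⁻¹ * Real.exp (-(|x| + s) ^ 2 / 2))) ≤ rawPval x := by
  rw [rawPval_eq_measureReal]
  have := gaussianReal_real_Ioc_ge (abs_nonneg x) hs
  have h2 : (gaussianReal 0 1).real (Set.Ioc |x| (|x| + s)) ≤
      (gaussianReal 0 1).real (Set.Ioi |x|) := measureReal_mono Set.Ioc_subset_Ioi_self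
  linarith

lemma rawPval_pos (x : ℝ) : 0 < rawPval x :=
  lt_of_lt_of_le (by positivity) (rawPval_ge x zero_le_one)

/-- A centered Gaussian variable of variance at most `V` is sub-Gaussian with parameter `V`. -/
lemma hasSubgaussianMGF_of_hasLaw {Ω : Type*} [MeasurableSpace Ω] {P : Measure Ω} {Z : Ω → ℝ}
    {v V : NNReal} (hZ : HasLaw Z (gaussianReal 0 v) P) (hv : v ≤ V) :
    HasSubgaussianMGF Z V P where
  integrable_exp_mul t := by
    have h := integrable_exp_mul_gaussianReal (μ := 0) (v := v) t
    rw [← hZ.map_eq] at h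
    exact (integrable_map_measure h.aestronglyMeasurable hZ.aemeasurable).1 h
  mgf_le t := by
    rw [mgf_gaussianReal hZ.map_eq]
    have : (v : ℝ) ≤ V := by exact_mod_cast hv
    gcongr
    nlinarith [sq_nonneg t]

/-- Two-sided Chernoff bound. -/
lemma measureReal_abs_ge_le_of_hasSubgaussianMGF {Ω : Type*} [MeasurableSpace Ω] {P : Measure Ω}
    [IsFiniteMeasure P] {Z : Ω → ℝ} {V : NNReal} (hZ : HasSubgaussianMGF Z V P) {t : ℝ}
    (ht : 0 ≤ t) :
    P.real {ω | t ≤ |Z ω|} ≤ 2 * Real.exp (-t ^ 2 / (2 * V)) := by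
  have h1 := hZ.measure_ge_le ht
  have h2 := hZ.neg.measure_ge_le ht
  have h3 : {ω | t ≤ |Z ω|} ⊆ {ω | t ≤ Z ω} ∪ {ω | t ≤ (-Z) ω} := by
    intro ω hω
    have h : t ≤ |Z ω| := hω
    exact le_abs.1 h
  have h4 := (measureReal_mono (μ := P) h3).trans (measureReal_union_le _ _)
  linarith

lemma rawPval_le (x : ℝ) : rawPval x ≤ 2 * Real.exp (-x ^ 2 / 2) := by
  have h := (hasSubgaussianMGF_of_hasLaw (HasLaw.id (μ := gaussianReal 0 1))
    le_rfl).measure_ge_le (abs_nonneg x)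
  have h2 : (gaussianReal 0 1).real (Set.Ioi |x|) ≤ (gaussianReal 0 1).real {ω | |x| ≤ id ω} :=
    measureReal_mono fun y (hy : |x| < y) => hy.le
  rw [rawPval_eq_measureReal]
  simp only [sq_abs, NNReal.coe_one, mul_one] at h
  linarith

/-- The raw `p`-value of a standard normal test statistic is stochastically at least as large as
a uniform variable. -/
lemma measureReal_rawPval_le {Ω : Type*} [MeasurableSpace Ω] {P : Measure Ω}
    {X : Ω → ℝ} (hX : HasLaw X (gaussianReal 0 1) P) {p : ℝ} (hp : 0 ≤ p) :
    P.real {ω | rawPval (X ω) ≤ p} ≤ p := by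
  have := hX.isProbabilityMeasure
  set S : Set ℝ := {x | 0 ≤ x ∧ rawPval x ≤ p} with hS
  rcases S.eq_empty_or_nonempty with h0 | hne
  · have : {ω | rawPval (X ω) ≤ p} = ∅ := by
      rw [Set.eq_empty_iff_forall_notMem]
      intro ω hω
      have : |X ω| ∈ S := ⟨abs_nonneg _, by simpa [rawPval] using hω⟩
      simp [h0] at this
    simpa [this] using hp
  have hbdd : BddBelow S := ⟨0, fun x hx => hx.1⟩
  set a := sInf S with ha
  have ha0 : 0 ≤ a := le_csInf hne fun x hx => hx.1
  have hcl : a ∈ closure S := csInf_mem_closure hne hbdd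
  -- Right continuity of the distribution function suffices for the infimum to be attained, so `a`
  -- acts as a generalized inverse of `rawPval`.
  have hcont : ContinuousWithinAt (cdf (gaussianReal 0 1)) S a :=
    ((cdf (gaussianReal 0 1)).right_continuous a).mono fun x hx => csInf_le hbdd hx
  have hmem : cdf (gaussianReal 0 1) a ∈ closure (Set.Ici (1 - p / 2)) := by
    refine hcont.mem_closure hcl fun x hx => ?_
    have := hx.2
    rw [rawPval, abs_of_nonneg hx.1] at this
    simp only [Set.mem_Ici]
    linarith
  rw [isClosed_Ici.closure_eq, Set.mem_Ici] at hmem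
  have hra : rawPval a ≤ p := by
    rw [rawPval, abs_of_nonneg ha0]
    linarith
  have hsub : {ω | rawPval (X ω) ≤ p} ⊆ {ω | X ω ∈ Set.Iic (-a) ∪ Set.Ici a} := by
    intro ω hω
    have h1 : a ≤ |X ω| := csInf_le hbdd ⟨abs_nonneg _, by simpa [rawPval] using hω⟩
    rcases le_abs.1 h1 with h | h
    · exact Or.inr h
    · exact Or.inl (by simp only [Set.mem_Iic]; linarith)
  refine (measureReal_mono hsub).trans ?_
  rw [hX.measureReal_eq (p := fun x => x ∈ Set.Iic (-a) ∪ Set.Ici a)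
    (measurableSet_Iic.union measurableSet_Ici)]
  refine (measureReal_union_le _ _).trans ?_
  rw [← measureReal_congr (Iio_ae_eq_Iic (μ := gaussianReal 0 1) (a := -a)),
    ← measureReal_congr (Ioi_ae_eq_Ici (μ := gaussianReal 0 1) (a := a)),
    gaussianReal_real_Iio_neg]
  rw [rawPval_eq_measureReal, abs_of_nonneg ha0] at hra
  linarith

/-- Gaussian lower bound for the raw `p`-value, uniform over shifts of the statistic. -/
lemma exists_rawPval_ge {κ : ℝ} (hκ : 0 < κ) (M : ℝ) :
    ∃ c : ℝ, 0 < c ∧ ∀ x y : ℝ, |x - y| ≤ M →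
      c * Real.exp (-(1 + κ) * y ^ 2 / 2) ≤ rawPval x := by
  refine ⟨2 * ((√(2 * Real.pi))⁻¹ * Real.exp (-(1 + κ⁻¹) * (M + 1) ^ 2 / 2)), by positivity,
    fun x y hxy => le_trans ?_ (rawPval_ge x zero_le_one)⟩
  rw [one_mul, mul_assoc, mul_assoc, ← Real.exp_add]
  gcongr
  have h1 : |x| ≤ |y| + M := by
    have := abs_sub_abs_le_abs_sub x y
    linarith
  have h2 : (|x| + 1) ^ 2 ≤ (|y| + (M + 1)) ^ 2 :=
    pow_le_pow_left₀ (by positivity) (by linarith) 2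
  -- Completing the square: the cross term `2 |y| (M + 1)` is absorbed into `κ y²` at the price of a
  -- constant.
  have h3 : 0 ≤ κ * (|y| - κ⁻¹ * (M + 1)) ^ 2 := by positivity
  have h4 : κ * (|y| - κ⁻¹ * (M + 1)) ^ 2 =
      κ * |y| ^ 2 - 2 * |y| * (M + 1) + κ⁻¹ * (M + 1) ^ 2 := by
    field_simp
    ring
  rw [h4, sq_abs] at h3
  nlinarith [sq_abs y]

/-- Enlarging the statistic by a fixed amount makes a small raw `p`-value smaller by any given
factor. -/
lemma exists_mul_rawPval_lt {m : ℝ} (hm : 0 < m) (D : ℝ) :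
    ∃ p₀ : ℝ, 0 < p₀ ∧ ∀ u v : ℝ, |v| + m ≤ |u| → rawPval v ≤ p₀ →
      D * rawPval u < rawPval v := by
  -- The mass of `(|v|, |v| + m / 2]` bounds `rawPval v` below. Going only half of the shift `m`
  -- leaves a factor `exp (-(m / 2) |v|)` to beat `D`.
  set c : ℝ := 2 * (m / 2 * (√(2 * Real.pi))⁻¹) with hc
  have hc0 : 0 < c := by positivity
  have htend : Tendsto (fun z : ℝ => |D| * (2 * Real.exp (-(m / 2 * z)))) atTop (𝓝 0) := by
    have : Tendsto (fun z : ℝ => Real.exp (-(m / 2 * z))) atTop (𝓝 0) :=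
      Real.tendsto_exp_neg_atTop_nhds_zero.comp (tendsto_id.const_mul_atTop (by positivity))
    simpa using (this.const_mul 2).const_mul |D|
  obtain ⟨z, hz0, hz⟩ := ((eventually_ge_atTop (0 : ℝ)).and
    (htend.eventually (gt_mem_nhds hc0))).exists
  refine ⟨rawPval z, rawPval_pos z, fun u v huv hv => ?_⟩
  have hzv : z ≤ |v| := by
    have := abs_le_of_rawPval_le hv
    rwa [abs_of_nonneg hz0] at this
  have h1 := rawPval_ge v (half_pos hm).le
  have h2 := rawPval_le u
  have h3 : (|v| + m) ^ 2 ≤ u ^ 2 := by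
    rw [← sq_abs u]
    exact pow_le_pow_left₀ (by positivity) huv 2
  have h4 : Real.exp (-u ^ 2 / 2) ≤
      Real.exp (-(m / 2 * z)) * Real.exp (-(|v| + m / 2) ^ 2 / 2) := by
    rw [← Real.exp_add]
    gcongr
    nlinarith [abs_nonneg v]
  have hE := Real.exp_pos (-(|v| + m / 2) ^ 2 / 2)
  calc D * rawPval u ≤ |D| * rawPval u := by
        gcongr
        · exact (rawPval_pos u).le
        · exact le_abs_self D
    _ ≤ |D| * (2 * (Real.exp (-(m / 2 * z)) * Real.exp (-(|v| + m / 2) ^ 2 / 2))) := by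
        gcongr
        linarith
    _ = (|D| * (2 * Real.exp (-(m / 2 * z)))) * Real.exp (-(|v| + m / 2) ^ 2 / 2) := by ring
    _ < c * Real.exp (-(|v| + m / 2) ^ 2 / 2) := by gcongr
    _ ≤ rawPval v := by
        rw [hc]
        linarith

end SCC

namespace SCC

/-! ### Joint tails of a bivariate normal pair -/

/-- The hypotheses on a pair of statistics used below: jointly normal, unit variances, the first
mean zero and the second mean `m`. -/
structure NormalPair {Ω : Type*} [MeasurableSpace Ω] (P : Measure Ω) (X Y : Ω → ℝ) (m : ℝ) :
    Prop where
  joint : HasGaussianLaw (fun ω => (X ω, Y ω)) P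
  fst : HasLaw X (gaussianReal 0 1) P
  snd : HasLaw Y (gaussianReal m 1) P

section NormalPair

variable {Ω : Type*} [MeasurableSpace Ω] {P : Measure Ω} {X Y : Ω → ℝ} {m : ℝ}

lemma integral_of_hasLaw_gaussianReal {v : NNReal} (h : HasLaw X (gaussianReal m v) P) :
    ∫ ω, X ω ∂P = m := by
  rw [h.integral_eq, integral_id_gaussianReal]

lemma variance_of_hasLaw_gaussianReal {v : NNReal} (h : HasLaw X (gaussianReal m v) P) :
    variance X P = v := by
  rw [h.variance_eq, variance_id_gaussianReal]

variable [IsProbabilityMeasure P]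

lemma NormalPair.hasLaw_add (h : NormalPair P X Y m) :
    HasLaw (fun ω => X ω + Y ω - m) (gaussianReal 0 (2 + 2 * covariance X Y P).toNNReal) P := by
  have hs := h.joint.fun_add
  have hl : HasLaw (fun ω => X ω + Y ω) _ P := ⟨hs.aemeasurable, hs.map_eq_gaussianReal⟩
  have h1 : ∫ ω, X ω + Y ω ∂P = m := by
    rw [integral_add h.joint.fst.integrable h.joint.snd.integrable,
      integral_of_hasLaw_gaussianReal h.fst, integral_of_hasLaw_gaussianReal h.snd, zero_add]
  have h2 : variance (fun ω => X ω + Y ω) P = 2 + 2 * covariance X Y P := by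
    rw [variance_fun_add h.joint.fst.memLp_two h.joint.snd.memLp_two,
      variance_of_hasLaw_gaussianReal h.fst, variance_of_hasLaw_gaussianReal h.snd]
    push_cast
    ring
  rw [h1, h2] at hl
  simpa using gaussianReal_sub_const hl m

lemma NormalPair.hasLaw_sub (h : NormalPair P X Y m) :
    HasLaw (fun ω => X ω - Y ω + m) (gaussianReal 0 (2 - 2 * covariance X Y P).toNNReal) P := by
  have hs := h.joint.fun_sub
  have hl : HasLaw (fun ω => X ω - Y ω) _ P := ⟨hs.aemeasurable, hs.map_eq_gaussianReal⟩
  have h1 : ∫ ω, X ω - Y ω ∂P = -m := by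
    rw [integral_sub h.joint.fst.integrable h.joint.snd.integrable,
      integral_of_hasLaw_gaussianReal h.fst, integral_of_hasLaw_gaussianReal h.snd, zero_sub]
  have h2 : variance (fun ω => X ω - Y ω) P = 2 - 2 * covariance X Y P := by
    rw [variance_fun_sub h.joint.fst.memLp_two h.joint.snd.memLp_two,
      variance_of_hasLaw_gaussianReal h.fst, variance_of_hasLaw_gaussianReal h.snd]
    push_cast
    ring
  rw [h1, h2] at hl
  simpa using gaussianReal_add_const hl m

/-- If both centered variables exceed `t` in absolute value, their sum or their difference exceeds
`2 t`. Both have variance at most `2 (1 + r)`, and the Chernoff bound applies to each. -/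
lemma NormalPair.measureReal_abs_ge_le (h : NormalPair P X Y m) {r : ℝ}
    (hcov : |covariance X Y P| ≤ r) {t : ℝ} (ht : 0 ≤ t) :
    P.real {ω | t ≤ |X ω| ∧ t ≤ |Y ω - m|} ≤ 4 * Real.exp (-t ^ 2 / (1 + r)) := by
  have hc := abs_le.1 hcov
  have hr : 0 ≤ r := (abs_nonneg _).trans hcov
  have hV : ((2 * (1 + r)).toNNReal : ℝ) = 2 * (1 + r) := Real.coe_toNNReal _ (by positivity)
  have b1 := measureReal_abs_ge_le_of_hasSubgaussianMGF (hasSubgaussianMGF_of_hasLaw h.hasLaw_add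
    (V := (2 * (1 + r)).toNNReal) (Real.toNNReal_le_toNNReal (by linarith)))
    (t := 2 * t) (by positivity)
  have b2 := measureReal_abs_ge_le_of_hasSubgaussianMGF (hasSubgaussianMGF_of_hasLaw h.hasLaw_sub
    (V := (2 * (1 + r)).toNNReal) (Real.toNNReal_le_toNNReal (by linarith)))
    (t := 2 * t) (by positivity)
  have he : -(2 * t) ^ 2 / (2 * (2 * (1 + r))) = -t ^ 2 / (1 + r) := by
    field_simp
  rw [hV, he] at b1 b2
  have hsub : {ω | t ≤ |X ω| ∧ t ≤ |Y ω - m|} ⊆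
      {ω | 2 * t ≤ |X ω + Y ω - m|} ∪ {ω | 2 * t ≤ |X ω - Y ω + m|} := by
    rintro ω ⟨h1, h2⟩
    simp only [Set.mem_union, Set.mem_ofPred_eq]
    rcases le_abs.1 h1 with h1 | h1 <;> rcases le_abs.1 h2 with h2 | h2
    · exact Or.inl (le_abs.2 (Or.inl (by linarith)))
    · exact Or.inr (le_abs.2 (Or.inl (by linarith)))
    · exact Or.inr (le_abs.2 (Or.inr (by linarith)))
    · exact Or.inl (le_abs.2 (Or.inr (by linarith)))
  have := (measureReal_mono (μ := P) hsub).trans (measureReal_union_le _ _)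
  linarith

end NormalPair

/-- If the correlation of a normal pair is at most `r` in absolute value, then the probability
that both raw `p`-values are at most `p` is of order `p ^ β` for every `β < 2 / (1 + r)`. -/
lemma exists_joint_tail {r β : ℝ} (hr : 0 ≤ r) (hβ : 0 < β) (hβr : β * (1 + r) < 2) (M : ℝ) :
    ∃ C : ℝ, 0 < C ∧ ∀ (Ω : Type*) [MeasurableSpace Ω] (P : Measure Ω) [IsProbabilityMeasure P]
      (X Y : Ω → ℝ) (m : ℝ), NormalPair P X Y m → |m| ≤ M → |covariance X Y P| ≤ r →
      ∀ p : ℝ, 0 < p →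
        P.real {ω | rawPval (X ω) ≤ p ∧ rawPval (Y ω) ≤ p} ≤ C * p ^ β := by
  have hden : 0 < β * (1 + r) := by positivity
  -- Chosen so that the loss `1 + κ` in the Gaussian lower bound turns the exponent `2 / (1 + r)`
  -- into exactly `β`.
  set κ : ℝ := 2 / (β * (1 + r)) - 1 with hκdef
  have hκ : 0 < κ := by
    rw [hκdef, sub_pos, lt_div_iff₀ hden]
    linarith
  obtain ⟨c, hc, hlow⟩ := exists_rawPval_ge hκ (max M 0)
  refine ⟨4 * c⁻¹ ^ β, by positivity, fun Ω _ P _ X Y m h hm hcov p hp => ?_⟩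
  have hrw : 4 * c⁻¹ ^ β * p ^ β = 4 * (p / c) ^ β := by
    rw [mul_assoc, ← Real.mul_rpow (by positivity) hp.le, div_eq_inv_mul]
  rw [hrw]
  rcases le_total c p with hcp | hpc
  · have h1 : 1 ≤ (p / c) ^ β := Real.one_le_rpow ((one_le_div hc).2 hcp) hβ.le
    have h2 : P.real {ω | rawPval (X ω) ≤ p ∧ rawPval (Y ω) ≤ p} ≤ 1 := measureReal_le_one
    linarith
  -- `√L` solves `c exp (-(1 + κ) y² / 2) = p`: a `p`-value at most `p` forces the centered
  -- statistic beyond it.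
  set L : ℝ := 2 / (1 + κ) * Real.log (c / p) with hL
  have hL0 : 0 ≤ L := by
    have := Real.log_nonneg ((one_le_div hp).2 hpc)
    positivity
  have key : ∀ x y : ℝ, |x - y| ≤ max M 0 → rawPval x ≤ p → √L ≤ |y| := by
    intro x y hxy hx
    have h1 := (hlow x y hxy).trans hx
    rw [← le_div_iff₀' hc, ← Real.le_log_iff_exp_le (by positivity), ← inv_div c p,
      Real.log_inv] at h1
    rw [Real.sqrt_le_left (abs_nonneg y), sq_abs, hL, div_mul_eq_mul_div,
      div_le_iff₀ (by positivity)]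
    linarith
  have hsub : {ω | rawPval (X ω) ≤ p ∧ rawPval (Y ω) ≤ p} ⊆
      {ω | √L ≤ |X ω| ∧ √L ≤ |Y ω - m|} := by
    rintro ω ⟨h1, h2⟩
    refine ⟨key (X ω) (X ω) (by simp) h1, key (Y ω) (Y ω - m) ?_ h2⟩
    simpa using Or.inl hm
  refine (measureReal_mono hsub).trans ((h.measureReal_abs_ge_le hcov (Real.sqrt_nonneg L)).trans ?_)
  rw [Real.sq_sqrt hL0, Real.rpow_def_of_pos (by positivity)]
  have h1κ : 1 + κ = 2 / (β * (1 + r)) := by rw [hκdef]; ring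
  have : -L / (1 + r) = Real.log (p / c) * β := by
    rw [hL, h1κ, ← inv_div c p, Real.log_inv]
    field_simp
  rw [this]

/-- A normal pair with correlation `± 1` is linearly dependent. -/
lemma NormalPair.ae_eq_of_abs_covariance_eq_one {Ω : Type*} [MeasurableSpace Ω] {P : Measure Ω}
    [IsProbabilityMeasure P] {X Y : Ω → ℝ} {m : ℝ} (h : NormalPair P X Y m)
    (hcov : |covariance X Y P| = 1) :
    (∀ᵐ ω ∂P, Y ω = X ω + m) ∨ ∀ᵐ ω ∂P, Y ω = -X ω + m := by
  rcases eq_or_eq_neg_of_abs_eq hcov with hc | hc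
  · left
    have hl := h.hasLaw_sub
    rw [hc, mul_one, sub_self, Real.toNNReal_zero, gaussianReal_zero_var] at hl
    filter_upwards [hl.ae_eq_of_dirac] with ω hω
    linarith
  · right
    have hl := h.hasLaw_add
    rw [hc, mul_neg_one, add_neg_cancel, Real.toNNReal_zero, gaussianReal_zero_var] at hl
    filter_upwards [hl.ae_eq_of_dirac] with ω hω
    linarith

lemma abs_covariance_le_one {Ω : Type*} [MeasurableSpace Ω] {P : Measure Ω}
    [IsProbabilityMeasure P] {X Y : Ω → ℝ} {m : ℝ} (h : NormalPair P X Y m) :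
    |covariance X Y P| ≤ 1 := by
  have hX := h.joint.fst.memLp_two
  have hY := h.joint.snd.memLp_two
  have v1 := variance_of_hasLaw_gaussianReal h.fst
  have v2 := variance_of_hasLaw_gaussianReal h.snd
  have h1 := variance_nonneg (X + Y) P
  have h2 := variance_nonneg (X - Y) P
  rw [variance_add hX hY, v1, v2] at h1
  rw [variance_sub hX hY, v1, v2] at h2
  push_cast at h1 h2
  rw [abs_le]
  constructor <;> linarith

/-! ### Cauchy variates -/

lemma cauchyVariate_strictAntiOn : StrictAntiOn cauchyVariate (Set.Ioo 0 1) := by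
  intro p hp q hq hpq
  have hπ := Real.pi_pos
  refine Real.strictMonoOn_tan ⟨?_, ?_⟩ ⟨?_, ?_⟩ ?_ <;> nlinarith [hp.1, hp.2, hq.1, hq.2]

lemma cauchyPval_cauchyVariate {p : ℝ} (hp : p ∈ Set.Ioo (0 : ℝ) 1) :
    cauchyPval (cauchyVariate p) = p := by
  have hπ := Real.pi_pos
  rw [cauchyPval, cauchyVariate, Real.arctan_tan (by nlinarith [hp.2]) (by nlinarith [hp.1])]
  field_simp
  ring

lemma cauchyPval_strictAnti : StrictAnti cauchyPval := by
  intro s t hst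
  have := Real.arctan_strictMono hst
  have h2 := div_lt_div_of_pos_right this Real.pi_pos
  simp only [cauchyPval]
  linarith

lemma cauchyPval_le_iff {t α : ℝ} (hα : α ∈ Set.Ioo (0 : ℝ) 1) :
    cauchyPval t ≤ α ↔ cauchyVariate α ≤ t := by
  conv_lhs => rw [← cauchyPval_cauchyVariate hα]
  exact cauchyPval_strictAnti.le_iff_ge

lemma cauchyPval_zero : cauchyPval 0 = 1 / 2 := by simp [cauchyPval]

lemma cauchyPval_eq_of_pos {t : ℝ} (ht : 0 < t) : cauchyPval t = Real.arctan t⁻¹ / Real.pi := by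
  rw [Real.arctan_inv_of_pos ht, cauchyPval]
  have := Real.pi_pos.ne'
  field_simp

lemma cauchyPval_le_inv {t : ℝ} (ht : 0 < t) : cauchyPval t ≤ (Real.pi * t)⁻¹ := by
  rw [cauchyPval_eq_of_pos ht, mul_inv, mul_comm, div_eq_mul_inv]
  gcongr
  have h0 : 0 ≤ Real.arctan t⁻¹ := Real.arctan_nonneg.2 (by positivity)
  simpa using Real.le_tan h0 (Real.arctan_lt_pi_div_two _)

/-- A crude lower bound for the Cauchy tail. -/
lemma le_cauchyPval {t : ℝ} (ht : 1 ≤ t) : (2 * Real.pi * t)⁻¹ ≤ cauchyPval t := by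
  have ht0 : 0 < t := by linarith
  rw [cauchyPval_eq_of_pos ht0, mul_comm 2, mul_assoc, mul_inv, mul_comm, div_eq_mul_inv]
  gcongr
  have h1 : t⁻¹ ≤ 1 := inv_le_one_of_one_le₀ ht
  have h2 : 0 < t⁻¹ := by positivity
  have h3 := Real.sin_le (Real.arctan_nonneg.2 h2.le)
  rw [Real.sin_arctan] at h3
  refine le_trans ?_ h3
  rw [mul_inv, mul_comm, ← div_eq_mul_inv]
  gcongr
  rw [Real.sqrt_le_left (by norm_num)]
  nlinarith

lemma rawPval_mem_Ioo {x : ℝ} (hx : x ≠ 0) : rawPval x ∈ Set.Ioo (0 : ℝ) 1 :=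
  ⟨rawPval_pos x, rawPval_lt_one hx⟩

lemma le_cauchyVariate_iff {p t : ℝ} (hp : p ∈ Set.Ioo (0 : ℝ) 1) :
    t ≤ cauchyVariate p ↔ p ≤ cauchyPval t := by
  conv_rhs => rw [← cauchyPval_cauchyVariate hp]
  exact cauchyPval_strictAnti.le_iff_ge.symm

lemma lt_cauchyVariate_iff {p t : ℝ} (hp : p ∈ Set.Ioo (0 : ℝ) 1) :
    t < cauchyVariate p ↔ p < cauchyPval t := by
  conv_rhs => rw [← cauchyPval_cauchyVariate hp]
  exact cauchyPval_strictAnti.lt_iff_gt.symm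

/-- At small levels the Cauchy quantile is asymptotic to `1 / (π α)`. -/
lemma eventually_inv_cauchyVariate_le {ε : ℝ} (hε : 0 < ε) :
    ∀ᶠ α in 𝓝[>] (0 : ℝ), (Real.pi * cauchyVariate α)⁻¹ ≤ (1 + ε) * α := by
  have hπ := Real.pi_pos
  have hcos : Tendsto (fun α : ℝ => (1 + ε) * Real.cos (α * Real.pi)) (𝓝[>] (0 : ℝ))
      (𝓝 (1 + ε)) := by
    have : Continuous fun α : ℝ => (1 + ε) * Real.cos (α * Real.pi) := by fun_prop
    simpa using (this.tendsto 0).mono_left nhdsWithin_le_nhds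
  filter_upwards [hcos.eventually (lt_mem_nhds (by linarith : 1 < 1 + ε)),
    self_mem_nhdsWithin] with α h1 (h2 : 0 < α)
  have hc : 0 < Real.cos (α * Real.pi) := by
    by_contra! h
    nlinarith
  -- The cotangent form reduces the claim to `sin x ≤ x` and to `cos (α π)` being close to `1`.
  have h3 : cauchyVariate α = (Real.tan (α * Real.pi))⁻¹ := by
    rw [← Real.tan_pi_div_two_sub, cauchyVariate]
    ring_nf
  rw [h3, mul_inv, inv_inv, Real.tan_eq_sin_div_cos, inv_mul_le_iff₀ hπ, div_le_iff₀ hc]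
  have h4 : Real.sin (α * Real.pi) ≤ α * Real.pi := Real.sin_le (by positivity)
  nlinarith [mul_pos h2 hπ]

lemma tendsto_cauchyVariate : Tendsto cauchyVariate (𝓝[>] (0 : ℝ)) atTop := by
  refine Real.tendsto_tan_pi_div_two.comp (tendsto_nhdsWithin_iff.2 ⟨?_, ?_⟩)
  · have : Continuous fun p : ℝ => (1 / 2 - p) * Real.pi := by fun_prop
    have h := (this.tendsto 0).mono_left (nhdsWithin_le_nhds (s := Set.Ioi 0))
    convert h using 2
    ring
  · filter_upwards [self_mem_nhdsWithin] with p (hp : 0 < p)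
    simp only [Set.mem_Iio]
    nlinarith [Real.pi_pos]

end SCC

namespace SCC

/-! ### Monotonicity of the procedure -/

variable {d : ℕ} {α : ℝ} {p : Fin d → ℝ}

lemma ranked_injective (p : Fin d → ℝ) : Function.Injective (ranked p) :=
  (Tuple.sort p).injective

lemma le_of_rank_le {i j : Fin d} (h : i ≤ j) : p (ranked p i) ≤ p (ranked p j) :=
  Tuple.monotone_sort p h

lemma mem_stepNext {s : ℕ} {i : Fin d} :
    i ∈ stepNext α p s ↔ ∃ k : Fin d, ((k : ℕ) + 1 + s = d ∧ sccPval p k ≤ α) ∧ ranked p k = i := by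
  simp [stepNext]

/-- The steps run through the ranks from the largest down without a stopping rule, so `s` steps test
exactly the last `s` ranks. -/
lemma mem_rejected {s : ℕ} {i : Fin d} :
    i ∈ rejected α p s ↔ ∃ k : Fin d, d ≤ k + s ∧ sccPval p k ≤ α ∧ ranked p k = i := by
  induction s with
  | zero =>
    simp only [rejected, Finset.notMem_empty, false_iff]
    rintro ⟨k, hk, -⟩
    have := k.2
    omega
  | succ s ih =>
    rw [rejected, Finset.mem_union, ih, mem_stepNext]
    constructor
    · rintro (⟨k, h1, h2, h3⟩ | ⟨k, ⟨h1, h2⟩, h3⟩)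
      · exact ⟨k, by omega, h2, h3⟩
      · exact ⟨k, by omega, h2, h3⟩
    · rintro ⟨k, h1, h2, h3⟩
      rcases Nat.lt_or_ge (k + s) d with h | h
      · exact Or.inr ⟨k, ⟨by omega, h2⟩, h3⟩
      · exact Or.inl ⟨k, h, h2, h3⟩

lemma mem_rejected_self {i : Fin d} :
    i ∈ rejected α p d ↔ ∃ k : Fin d, sccPval p k ≤ α ∧ ranked p k = i := by
  simp [mem_rejected]

lemma rejected_mono {s l : ℕ} (h : s ≤ l) : rejected α p s ⊆ rejected α p l := by
  intro i hi
  obtain ⟨k, h1, h2, h3⟩ := mem_rejected.1 hi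
  exact mem_rejected.2 ⟨k, by omega, h2, h3⟩

lemma stepNext_subset {s l : ℕ} (h : s ≤ l) :
    stepNext α p s ⊆ stepNext α p l ∪ rejected α p l := by
  rcases h.eq_or_lt with rfl | h
  · exact Finset.subset_union_left
  · exact (Finset.subset_union_right.trans (rejected_mono (s := s + 1) h)).trans
      Finset.subset_union_right

lemma mem_successor {R : Finset (Fin d)} {i : Fin d} :
    i ∈ successor α p R ↔ ∃ k : Fin d,
      (ranked p k ∉ R ∧ (∀ j < k, ranked p j ∈ R) ∧ sccPval p k ≤ α) ∧ ranked p k = i := by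
  simp [successor]

/-- The candidate for `R` either lies in `S` already or is still the first hypothesis outside `S`;
its SCC `p`-value does not depend on the set. -/
lemma successor_subset {R S : Finset (Fin d)} (h : R ⊆ S) :
    successor α p R ⊆ successor α p S ∪ S := by
  intro i hi
  obtain ⟨k, ⟨-, h2, h3⟩, rfl⟩ := mem_successor.1 hi
  by_cases hk : ranked p k ∈ S
  · exact Finset.mem_union_right _ hk
  · exact Finset.mem_union_left _ (mem_successor.2 ⟨k, ⟨hk, fun j hj => h (h2 j hj), h3⟩, rfl⟩)

/-- For `α ≤ 1 / 2` the ranks with SCC `p`-value at most `α` form an initial segment. -/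
lemma sccPval_le_of_rank_le (hp : ∀ i, p i ∈ Set.Ioo (0 : ℝ) 1) (hα : α ≤ 1 / 2) {j k : Fin d}
    (hjk : j ≤ k) (hk : sccPval p k ≤ α) : sccPval p j ≤ α := by
  have hd : 0 < (d : ℝ) := by exact_mod_cast (Nat.zero_le _).trans_lt k.2
  have hY : ∀ a b : Fin d, a ≤ b →
      cauchyVariate (p (ranked p b)) ≤ cauchyVariate (p (ranked p a)) := fun a b hab =>
    cauchyVariate_strictAntiOn.antitoneOn (hp _) (hp _) (le_of_rank_le hab)
  have hstat : 0 ≤ sccStat p k := by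
    rw [← cauchyPval_strictAnti.le_iff_ge, cauchyPval_zero]
    exact hk.trans hα
  -- The tail sum is nonnegative and its largest term is the one of rank `k`, so that term and all
  -- terms of smaller rank are nonnegative.
  have hYk : 0 ≤ cauchyVariate (p (ranked p k)) := by
    by_contra! hneg
    refine absurd hstat (not_le.2 (Finset.sum_neg (fun l hl => ?_) ⟨k, Finset.mem_Ici.2 le_rfl⟩))
    exact mul_neg_of_pos_of_neg (by positivity) ((hY k l (Finset.mem_Ici.1 hl)).trans_lt hneg)
  refine le_trans (cauchyPval_strictAnti.antitone ?_) hk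
  refine Finset.sum_le_sum_of_subset_of_nonneg (Finset.Ici_subset_Ici.2 hjk) fun l _ hl => ?_
  rw [Finset.mem_Ici, not_le] at hl
  exact mul_nonneg (by positivity) (hYk.trans (hY l k hl.le))

/-- Unlike the stepwise procedure, the iteration starts at the smallest `p`-value and stalls at the
first rank that fails. -/
lemma mem_iterate_successor {s : ℕ} {i : Fin d} :
    i ∈ iterate (successor α p) s ↔
      ∃ k : Fin d, (k : ℕ) < s ∧ (∀ j ≤ k, sccPval p j ≤ α) ∧ ranked p k = i := by
  induction s generalizing i with
  | zero => simp [iterate]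
  | succ s ih =>
    rw [iterate, Finset.mem_union]
    constructor
    · rintro (h | h)
      · obtain ⟨k, h1, h2⟩ := ih.1 h
        exact ⟨k, by omega, h2⟩
      · obtain ⟨k, ⟨-, h2, h3⟩, rfl⟩ := mem_successor.1 h
        have hprev : ∀ j < k, (j : ℕ) < s ∧ sccPval p j ≤ α := by
          intro j hj
          obtain ⟨j', h4, h5, h6⟩ := ih.1 (h2 j hj)
          rw [ranked_injective p h6] at h4 h5
          exact ⟨h4, h5 j le_rfl⟩
        refine ⟨k, ?_, fun j hj => ?_, rfl⟩
        -- Otherwise rank `s` would precede `k` and be in the iterate after `s` rounds, which only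
        -- contains ranks below `s`.
        · by_contra! hk
          have := (hprev ⟨s, by omega⟩ (Fin.lt_def.2 (by simp only; omega))).1
          simp at this
        · rcases hj.lt_or_eq with hj | rfl
          · exact (hprev j hj).2
          · exact h3
    · rintro ⟨k, h1, h2, rfl⟩
      by_cases hmem : ranked p k ∈ iterate (successor α p) s
      · exact Or.inl hmem
      · refine Or.inr (mem_successor.2 ⟨k, ⟨hmem, fun j hj => ?_, h2 k le_rfl⟩, rfl⟩)
        exact ih.2 ⟨j, by have := Fin.lt_def.1 hj; omega, fun l hl => h2 l (hl.trans hj.le), rfl⟩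

lemma iterate_successor_eq_rejected (hp : ∀ i, p i ∈ Set.Ioo (0 : ℝ) 1) (hα : α ≤ 1 / 2) :
    iterate (successor α p) d = rejected α p d := by
  ext i
  rw [mem_iterate_successor, mem_rejected_self]
  constructor
  · rintro ⟨k, -, h2, h3⟩
    exact ⟨k, h2 k le_rfl, h3⟩
  · rintro ⟨k, h1, h2⟩
    exact ⟨k, k.2, fun j hj => sccPval_le_of_rank_le hp hα hj h1, h2⟩

section Probability

variable {Ω : Type*} [MeasurableSpace Ω] {P : Measure Ω} {X : Fin d → Ω → ℝ} {F : Finset (Fin d)}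

/-- A raw `p`-value equals `1` only where the statistic vanishes, a null event. It must be excluded
because `Real.tan (-π / 2) = 0` would break the monotonicity of `cauchyVariate`. -/
lemma PairwiseNormal.ae_pvals_mem (h : PairwiseNormal P X F) :
    ∀ᵐ ω ∂P, ∀ i, pvals X ω i ∈ Set.Ioo (0 : ℝ) 1 := by
  rw [ae_all_iff]
  intro i
  have : NullSingletonClass (gaussianReal (∫ ω, X i ω ∂P) 1) :=
    nullSingletonClass_gaussianReal one_ne_zero
  have h0 : ∀ᵐ x ∂(gaussianReal (∫ ω, X i ω ∂P) 1), x ≠ 0 := by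
    simp [ae_iff]
  rw [← (h.standardized i).map_eq] at h0
  filter_upwards [ae_of_ae_map (h.standardized i).aemeasurable h0] with ω hω
  exact rawPval_mem_Ioo hω

lemma PairwiseNormal.monotonicity (h : PairwiseNormal P X F) (α : ℝ) : Monotonicity P X α where
  step _ _ hsl _ := .of_forall fun _ => ⟨rejected_mono hsl, stepNext_subset hsl⟩
  sets _ _ hRS := .of_forall fun _ => successor_subset hRS
  generates hα := by
    filter_upwards [h.ae_pvals_mem] with ω hω
    exact iterate_successor_eq_rejected hω hα

end Probability

/-! ### Reduction of all errors to one event -/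

/-- Some true hypothesis has the smallest `p`-value in a set of hypotheses whose average Cauchy
variate (with weights `1 / d`) is at least `h`. -/
def Offending (p : Fin d → ℝ) (F : Finset (Fin d)) (h : ℝ) : Prop :=
  ∃ (S : Finset (Fin d)) (k : Fin d), k ∉ F ∧ k ∈ S ∧ (∀ j ∈ S, p k ≤ p j) ∧
    d * h ≤ ∑ j ∈ S, cauchyVariate (p j)

lemma mul_le_sum_of_combPval_le (hα : α ∈ Set.Ioo (0 : ℝ) 1) {S : Finset (Fin d)}
    {k : Fin d} (hS : combPval p S ≤ α) :
    d * cauchyVariate α ≤ ∑ j ∈ S, cauchyVariate (p j) := by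
  have hd : 0 < (d : ℝ) := by exact_mod_cast (Nat.zero_le _).trans_lt k.2
  rw [combPval, cauchyPval_le_iff hα, ← Finset.mul_sum, one_div, le_inv_mul_iff₀ hd] at hS
  exact hS

lemma offending_of_combPval_le {F : Finset (Fin d)} (hα : α ∈ Set.Ioo (0 : ℝ) (1 / 2))
    (h : combPval p Fᶜ ≤ α) : Offending p F (cauchyVariate α) := by
  -- Without true hypotheses the empty combination has `p`-value `1 / 2`, hence the need for `α < 1
  -- / 2`.
  rcases (Fᶜ).eq_empty_or_nonempty with h0 | hne
  · rw [h0, combPval, Finset.sum_empty, cauchyPval_zero] at h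
    exact absurd h (not_le.2 hα.2)
  · obtain ⟨k, hk, hmin⟩ := Finset.exists_min_image Fᶜ p hne
    exact ⟨Fᶜ, k, Finset.mem_compl.1 hk, hk, hmin,
      mul_le_sum_of_combPval_le (k := k) ⟨hα.1, by linarith [hα.2]⟩ h⟩

lemma offending_of_sccPval_le {F : Finset (Fin d)} (hα : α ∈ Set.Ioo (0 : ℝ) (1 / 2)) {k : Fin d}
    (hk : ranked p k ∉ F) (h : sccPval p k ≤ α) : Offending p F (cauchyVariate α) := by
  rw [sccPval_eq_combPval] at h
  refine ⟨nullFrom p k, ranked p k, hk, ?_, ?_,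
    mul_le_sum_of_combPval_le (k := k) ⟨hα.1, by linarith [hα.2]⟩ h⟩
  · exact Finset.mem_image_of_mem _ (Finset.mem_Ici.2 le_rfl)
  · intro j hj
    obtain ⟨l, hl, rfl⟩ := Finset.mem_image.1 hj
    exact le_of_rank_le (Finset.mem_Ici.1 hl)

/-- Subadditivity in place of complementation, so that no event has to be shown measurable. -/
lemma one_sub_measureReal_le {Ω : Type*} [MeasurableSpace Ω] {P : Measure Ω}
    [IsProbabilityMeasure P] {s t : Set Ω} (h : sᶜ ⊆ t) : 1 - P.real t ≤ P.real s := by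
  have h1 : P.real (Set.univ : Set Ω) ≤ P.real s + P.real t :=
    (measureReal_mono fun ω _ => by
      by_cases hω : ω ∈ s
      · exact Or.inl hω
      · exact Or.inr (h hω)).trans (measureReal_union_le s t)
  rw [probReal_univ] at h1
  linarith

lemma errorBounds_of_offending {Ω : Type*} [MeasurableSpace Ω] {P : Measure Ω}
    [IsProbabilityMeasure P] {X : Fin d → Ω → ℝ} {F : Finset (Fin d)} {ε : ℝ}
    (hα : α ∈ Set.Ioo (0 : ℝ) (1 / 2))
    (h : P.real {ω | Offending (pvals X ω) F (cauchyVariate α)} ≤ (1 + ε) * α) :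
    ErrorBounds P X F α ε where
  critical := (measureReal_mono fun ω hω => offending_of_combPval_le hα hω).trans h
  single_step := by
    refine le_trans (by linarith) (one_sub_measureReal_le
      (t := {ω | Offending (pvals X ω) F (cauchyVariate α)}) fun ω hω => ?_)
    obtain ⟨i, hi, hiF⟩ := Finset.not_subset.1 hω
    obtain ⟨k, ⟨-, -, h3⟩, rfl⟩ := mem_successor.1 hi
    exact offending_of_sccPval_le hα hiF h3
  fwer := by
    refine le_trans (by linarith) (one_sub_measureReal_le
      (t := {ω | Offending (pvals X ω) F (cauchyVariate α)}) fun ω hω => ?_)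
    obtain ⟨i, hi, hiF⟩ := Finset.not_subset.1 hω
    obtain ⟨k, h3, rfl⟩ := mem_rejected_self.1 hi
    exact offending_of_sccPval_le hα hiF h3

end SCC

namespace SCC

/-! ### The principle of a single big jump -/

variable {d : ℕ}

/-- The event that the average Cauchy variate is large although the most extreme true hypothesis
`k` does not account for a proportion `1 - δ` of it; `R` relates hypotheses with the same
`p`-value. -/
def Residual (p : Fin d → ℝ) (F : Finset (Fin d)) (R : Fin d → Fin d → Prop) (δ h : ℝ) : Prop :=
  ∃ (S : Finset (Fin d)) (k : Fin d), k ∉ F ∧ (∀ j ∈ S, p k ≤ p j ∧ ¬ R k j) ∧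
    cauchyVariate (p k) ≤ d * h ∧ δ * (d * h) ≤ ∑ j ∈ S, cauchyVariate (p j)

open Classical in
-- Split `S` into the class of `k` and the rest. If the class falls short of `(1 - δ) d h`, so does
-- the single variate of `k`, and the rest must supply `δ d h`.
lemma residual_of_offending {p : Fin d → ℝ} (hp : ∀ i, p i ∈ Set.Ioo (0 : ℝ) 1)
    {F : Finset (Fin d)} {R : Fin d → Fin d → Prop} (hrefl : ∀ k, R k k)
    (hR : ∀ j k, R k j → p k = p j) {δ h : ℝ} (hδ : 0 < δ) (hh : 0 < h)
    (hoff : Offending p F h) :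
    (∃ k ∉ F, (1 - δ) * (d * h) ≤ (Finset.univ.filter (R k)).card * cauchyVariate (p k)) ∨
      Residual p F R δ h := by
  obtain ⟨S, k, hkF, hkS, hmin, hsum⟩ := hoff
  have hd : 0 < (d : ℝ) := by exact_mod_cast (Nat.zero_le _).trans_lt k.2
  have hdh : 0 < d * h := by positivity
  rcases le_or_gt ((1 - δ) * (d * h))
    ((Finset.univ.filter (R k)).card * cauchyVariate (p k)) with hbig | hsmall
  · exact Or.inl ⟨k, hkF, hbig⟩
  refine Or.inr ⟨S.filter fun j => ¬ R k j, k, hkF, fun j hj => ?_, ?_, ?_⟩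
  · rw [Finset.mem_filter] at hj
    exact ⟨hmin j hj.1, hj.2⟩
  all_goals
    have hle : ∀ j ∈ S, cauchyVariate (p j) ≤ cauchyVariate (p k) := fun j hj =>
      cauchyVariate_strictAntiOn.antitoneOn (hp _) (hp _) (hmin j hj)
    have hk0 : 0 ≤ cauchyVariate (p k) := by
      by_contra! hneg
      have := Finset.sum_nonpos fun j hj => (hle j hj).trans hneg.le
      linarith
    have hm : (1 : ℝ) ≤ (Finset.univ.filter (R k)).card := by
      exact_mod_cast Finset.card_pos.2 ⟨k, by simp [hrefl]⟩
  · nlinarith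
  · have hsame : ∑ j ∈ S with R k j, cauchyVariate (p j) ≤
        (Finset.univ.filter (R k)).card * cauchyVariate (p k) := by
      rw [Finset.sum_congr rfl fun j hj => by rw [← hR j k (Finset.mem_filter.1 hj).2],
        Finset.sum_const, nsmul_eq_mul]
      gcongr
      exact Finset.subset_univ S
    have := Finset.sum_filter_add_sum_filter_not S (R k) fun j => cauchyVariate (p j)
    linarith

section Probability

variable {Ω : Type*} [MeasurableSpace Ω] {P : Measure Ω} {X : Fin d → Ω → ℝ}
  {F : Finset (Fin d)}

/-- Two hypotheses whose raw `p`-values agree almost surely. -/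
def SamePval (P : Measure Ω) (X : Fin d → Ω → ℝ) (k j : Fin d) : Prop :=
  ∀ᵐ ω ∂P, pvals X ω k = pvals X ω j

lemma samePval_equivalence (P : Measure Ω) (X : Fin d → Ω → ℝ) : Equivalence (SamePval P X) where
  refl _ := .of_forall fun _ => rfl
  symm h := h.mono fun _ => Eq.symm
  trans h h' := by
    filter_upwards [h, h'] with ω h1 h2
    exact h1.trans h2

lemma PairwiseNormal.hasLaw (h : PairwiseNormal P X F) {k : Fin d} (hk : k ∉ F) :
    HasLaw (X k) (gaussianReal 0 1) P := by
  simpa [h.mean_zero k hk] using h.standardized k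

variable [IsProbabilityMeasure P]

lemma PairwiseNormal.measureReal_cauchyVariate_ge (h : PairwiseNormal P X F) {k : Fin d}
    (hk : k ∉ F) {t : ℝ} (ht : 0 < t) :
    P.real {ω | t ≤ cauchyVariate (pvals X ω k)} ≤ (Real.pi * t)⁻¹ := by
  have h1 : P.real {ω | t ≤ cauchyVariate (pvals X ω k)} ≤
      P.real {ω | rawPval (X k ω) ≤ cauchyPval t} := by
    refine ENNReal.toReal_mono (measure_ne_top _ _) (measure_mono_ae ?_)
    filter_upwards [h.ae_pvals_mem] with ω hω
    exact (le_cauchyVariate_iff (hω k)).1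
  refine h1.trans ((measureReal_rawPval_le (h.hasLaw hk) ?_).trans (cauchyPval_le_inv ht))
  rw [cauchyPval_eq_of_pos ht]
  have := Real.arctan_nonneg.2 (inv_pos.2 ht).le
  have := Real.pi_pos
  positivity

open Classical in
/-- The probability that one class of hypotheses with the same `p`-value accounts for the average
is of the order of the nominal level. -/
lemma PairwiseNormal.measureReal_class_le (h : PairwiseNormal P X F) {t : ℝ} (ht : 0 < t) :
    P.real {ω | ∃ k ∉ F, d * t ≤
      (Finset.univ.filter (SamePval P X k)).card * cauchyVariate (pvals X ω k)} ≤
      (Real.pi * t)⁻¹ := by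
  have hπ := Real.pi_pos
  rcases Nat.eq_zero_or_pos d with hd | hd
  · subst hd
    have : 0 ≤ (Real.pi * t)⁻¹ := by positivity
    simpa using this
  have hd' : (0 : ℝ) < d := by exact_mod_cast hd
  have : Nonempty (Fin d) := ⟨⟨0, hd⟩⟩
  have heqv := samePval_equivalence P X
  set cls : Fin d → Finset (Fin d) := fun k => Finset.univ.filter (SamePval P X k) with hcls
  have hmem : ∀ k, k ∈ cls k := fun k => by simp [hcls, heqv.refl]
  have hcls_eq : ∀ k j, SamePval P X k j → cls k = cls j := by
    intro k j hkj
    ext l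
    simp only [hcls, Finset.mem_filter, Finset.mem_univ, true_and]
    exact ⟨fun hl => heqv.trans (heqv.symm hkj) hl, fun hl => heqv.trans hkj hl⟩
  set Q : Finset (Finset (Fin d)) := Fᶜ.image cls with hQ
  have hrep : ∀ c ∈ Q, ∃ k, k ∉ F ∧ cls k = c := by
    intro c hc
    obtain ⟨k, hk, rfl⟩ := Finset.mem_image.1 hc
    exact ⟨k, Finset.mem_compl.1 hk, rfl⟩
  -- One true representative per class: the union bound runs over classes, which keeps the total
  -- weight at most `d` even under perfect dependence.
  choose! rep hrepF hrepc using hrep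
  have hcard : ∑ c ∈ Q, (c.card : ℝ) ≤ d := by
    have hdisj : (Q : Set (Finset (Fin d))).PairwiseDisjoint id := by
      intro c hc c' hc' hne
      obtain ⟨k, -, rfl⟩ := Finset.mem_image.1 hc
      obtain ⟨k', -, rfl⟩ := Finset.mem_image.1 hc'
      refine Finset.disjoint_left.2 fun l hl hl' => hne ?_
      simp only [id, hcls, Finset.mem_filter, Finset.mem_univ, true_and] at hl hl'
      exact hcls_eq k k' (heqv.trans hl (heqv.symm hl'))
    have := (Finset.card_biUnion hdisj).symm.trans_le (Finset.card_le_univ (Q.biUnion id))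
    rw [Fintype.card_fin] at this
    exact_mod_cast this
  have hae : ∀ᵐ ω ∂P, ∀ k j, SamePval P X k j → pvals X ω k = pvals X ω j := by
    simp only [ae_all_iff]
    exact fun k j hkj => hkj
  have hsub : P.real {ω | ∃ k ∉ F, d * t ≤ (cls k).card * cauchyVariate (pvals X ω k)} ≤
      P.real (⋃ c ∈ Q, {ω | d * t / c.card ≤ cauchyVariate (pvals X ω (rep c))}) := by
    refine ENNReal.toReal_mono (measure_ne_top _ _) (measure_mono_ae ?_)
    filter_upwards [hae] with ω hω
    rintro ⟨k, hk, hle⟩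
    have hkQ : cls k ∈ Q := Finset.mem_image_of_mem _ (Finset.mem_compl.2 hk)
    refine Set.mem_iUnion₂.2 ⟨cls k, hkQ, ?_⟩
    have hsame : SamePval P X k (rep (cls k)) := by
      have := hmem (rep (cls k))
      rw [hrepc _ hkQ] at this
      simpa [hcls] using this
    have hpos : (0 : ℝ) < (cls k).card := by exact_mod_cast Finset.card_pos.2 ⟨k, hmem k⟩
    show d * t / (cls k).card ≤ cauchyVariate (pvals X ω (rep (cls k)))
    rw [← hω _ _ hsame, div_le_iff₀' hpos]
    exact hle
  refine hsub.trans ((measureReal_biUnion_finset_le _ _).trans ?_)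
  calc ∑ c ∈ Q, P.real {ω | d * t / c.card ≤ cauchyVariate (pvals X ω (rep c))}
      ≤ ∑ c ∈ Q, c.card * (Real.pi * (d * t))⁻¹ := by
        refine Finset.sum_le_sum fun c hc => ?_
        have hpos : (0 : ℝ) < c.card := by
          rw [← hrepc c hc]
          exact_mod_cast Finset.card_pos.2 ⟨_, hmem _⟩
        refine (h.measureReal_cauchyVariate_ge (hrepF c hc) (by positivity)).trans_eq ?_
        field_simp
    _ = (∑ c ∈ Q, (c.card : ℝ)) * (Real.pi * (d * t))⁻¹ := (Finset.sum_mul _ _ _).symm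
    _ ≤ d * (Real.pi * (d * t))⁻¹ := by gcongr
    _ = (Real.pi * t)⁻¹ := by field_simp

lemma PairwiseNormal.measureReal_offending_le (hX : PairwiseNormal P X F) {δ h : ℝ} (hδ : 0 < δ)
    (hδ1 : δ < 1) (hh : 0 < h) :
    P.real {ω | Offending (pvals X ω) F h} ≤
      (Real.pi * ((1 - δ) * h))⁻¹ +
        P.real {ω | Residual (pvals X ω) F (SamePval P X) δ h} := by
  classical
  have ht : 0 < (1 - δ) * h := mul_pos (by linarith) hh
  refine le_trans ?_ (add_le_add_left (hX.measureReal_class_le ht) _)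
  refine le_trans ?_ (measureReal_union_le _ _)
  refine ENNReal.toReal_mono (measure_ne_top _ _) (measure_mono_ae ?_)
  have hae : ∀ᵐ ω ∂P, ∀ j k, SamePval P X k j → pvals X ω k = pvals X ω j := by
    simp only [ae_all_iff]
    exact fun k j hkj => hkj
  filter_upwards [hX.ae_pvals_mem, hae] with ω h1 h2 hoff
  rcases residual_of_offending h1 (samePval_equivalence P X).refl h2 hδ hh hoff with h3 | h3
  · left
    obtain ⟨k, hk, hle⟩ := h3
    refine ⟨k, hk, ?_⟩
    convert hle using 1
    ring
  · exact Or.inr h3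

end Probability

/-- It suffices that the residual event has probability of smaller order than the level. -/
lemma eventually_errorBounds {ι : Type*} {l : Filter ι} {d : ι → ℕ} {Ω : ι → Type*}
    [∀ n, MeasurableSpace (Ω n)] {P : ∀ n, Measure (Ω n)} [∀ n, IsProbabilityMeasure (P n)]
    {X : ∀ n, Fin (d n) → Ω n → ℝ} {F : ∀ n, Finset (Fin (d n))} {α : ι → ℝ}
    (hα : Tendsto α l (𝓝[>] (0 : ℝ))) (hX : ∀ n, PairwiseNormal (P n) (X n) (F n))
    (hres : ∀ δ c : ℝ, 0 < δ → 0 < c → ∀ᶠ n in l,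
      (P n).real {ω | Residual (pvals (X n) ω) (F n) (SamePval (P n) (X n)) δ
        (cauchyVariate (α n))} ≤ c / cauchyVariate (α n)) {ε : ℝ} (hε : 0 < ε) :
    ∀ᶠ n in l, ErrorBounds (P n) (X n) (F n) (α n) ε := by
  have hπ := Real.pi_pos
  -- With `δ = e / (1 + e)` one has `1 / (1 - δ) = 1 + e`. The residual adds another `e` and the
  -- quantile asymptotics a factor `1 + e`; `(1 + 2 e) (1 + e) ≤ 1 + 4 e` as `e ≤ 1 / 4`.
  set e : ℝ := min ε 1 / 4 with he
  have he0 : 0 < e := by positivity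
  have he1 : e ≤ 1 / 4 := by
    have := min_le_right ε 1
    linarith
  have heε : 4 * e ≤ ε := by
    have := min_le_left ε 1
    linarith
  have hδ0 : 0 < e / (1 + e) := by positivity
  have hδ1 : e / (1 + e) < 1 := by
    rw [div_lt_one (by positivity)]
    linarith
  have hsmall : ∀ᶠ n in l, α n ∈ Set.Ioo (0 : ℝ) (1 / 2) :=
    hα.eventually (Ioo_mem_nhdsGT (by norm_num))
  filter_upwards [hsmall, hα.eventually (eventually_inv_cauchyVariate_le he0),
    (tendsto_cauchyVariate.comp hα).eventually (eventually_gt_atTop 0),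
    hres (e / (1 + e)) (e / Real.pi) hδ0 (by positivity)] with n h1 h2 h3 h4
  replace h3 : 0 < cauchyVariate (α n) := h3
  refine errorBounds_of_offending h1 (((hX n).measureReal_offending_le hδ0 hδ1 h3).trans ?_)
  have h5 : (Real.pi * ((1 - e / (1 + e)) * cauchyVariate (α n)))⁻¹ +
      e / Real.pi / cauchyVariate (α n) = (1 + 2 * e) * (Real.pi * cauchyVariate (α n))⁻¹ := by
    have : 1 - e / (1 + e) = (1 + e)⁻¹ := by
      field_simp
      ring
    rw [this]
    field_simp
    ring
  calc _ ≤ (1 + 2 * e) * (Real.pi * cauchyVariate (α n))⁻¹ := by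
        rw [← h5]
        gcongr
    _ ≤ (1 + 2 * e) * ((1 + e) * α n) := by gcongr
    _ = (1 + 2 * e) * (1 + e) * α n := by ring
    _ ≤ (1 + ε) * α n := by
        have := h1.1
        gcongr
        nlinarith

end SCC

namespace SCC

/-! ### The residual event -/

lemma exists_div_le_of_le_sum {ι : Type*} {S : Finset ι} {f : ι → ℝ} {a K : ℝ} (ha : 0 < a)
    (hS : (S.card : ℝ) ≤ K) (h : a ≤ ∑ j ∈ S, f j) : ∃ j ∈ S, a / K ≤ f j := by
  have hne : S.Nonempty := by
    rw [Finset.nonempty_iff_ne_empty]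
    rintro rfl
    rw [Finset.sum_empty] at h
    linarith
  have hK : 0 < K := lt_of_lt_of_le (by exact_mod_cast Finset.card_pos.2 hne) hS
  by_contra! hlt
  have h1 := Finset.sum_lt_sum_of_nonempty hne hlt
  rw [Finset.sum_const, nsmul_eq_mul] at h1
  have h2 : S.card * (a / K) ≤ K * (a / K) := by gcongr
  rw [mul_div_cancel₀ _ hK.ne'] at h2
  linarith

lemma eventually_mul_rpow_le {β C c : ℝ} (hβ : 1 < β) (hc : 0 < c) :
    ∀ᶠ h : ℝ in atTop, C * h ^ (-β) ≤ c / h := by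
  have h1 := (tendsto_rpow_neg_atTop (sub_pos.2 hβ)).const_mul C
  rw [mul_zero] at h1
  filter_upwards [h1.eventually (gt_mem_nhds hc), eventually_gt_atTop 0] with h h2 h3
  rw [le_div_iff₀ h3]
  refine le_trans (le_of_eq ?_) h2.le
  rw [neg_sub, sub_eq_add_neg, add_comm, Real.rpow_add h3, Real.rpow_one]
  ring

variable {d : ℕ} {Ω : Type*} [MeasurableSpace Ω] {P : Measure Ω}
  {X : Fin d → Ω → ℝ} {F : Finset (Fin d)}

lemma PairwiseNormal.normalPair (h : PairwiseNormal P X F) {k j : Fin d} (hk : k ∉ F)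
    (hkj : k ≠ j) : NormalPair P (X k) (X j) (∫ ω, X j ω ∂P) where
  joint := by
    rcases lt_or_gt_of_ne hkj with hlt | hlt
    · exact h.bivariate k j hlt
    · exact (h.bivariate j k hlt).map_equiv_fun (ContinuousLinearEquiv.prodComm ℝ ℝ ℝ)
  fst := h.hasLaw hk
  snd := h.standardized j

lemma rawPval_le_inv_of_le_cauchyVariate {x t : ℝ} (hx : rawPval x ∈ Set.Ioo (0 : ℝ) 1)
    (ht : 0 < t) (h : t ≤ cauchyVariate (rawPval x)) : rawPval x ≤ t⁻¹ := by
  refine ((le_cauchyVariate_iff hx).1 h).trans ((cauchyPval_le_inv ht).trans ?_)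
  have := Real.pi_gt_three
  gcongr
  nlinarith

/-- Two statistics that differ by a nonzero shift, up to sign, cannot both produce `p`-values of
the same small order. -/
lemma eventually_not_of_shift {m δ D : ℝ} (hm : m ≠ 0) (hδ : 0 < δ) (hD : 1 ≤ D) :
    ∀ᶠ h : ℝ in atTop, ∀ x y : ℝ, (y = x + m ∨ y = -x + m) →
      rawPval x ∈ Set.Ioo (0 : ℝ) 1 → rawPval y ∈ Set.Ioo (0 : ℝ) 1 →
      ¬ (rawPval x ≤ rawPval y ∧ cauchyVariate (rawPval x) ≤ D * h ∧
        δ * h ≤ cauchyVariate (rawPval y)) := by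
  -- `2 D / δ` is the ratio of the upper bound `1 / (π δ h)` for `rawPval y` to the lower bound `1 /
  -- (2 π D h)` for `rawPval x`.
  obtain ⟨p₀, hp₀, hlt⟩ := exists_mul_rawPval_lt (abs_pos.2 hm) (2 * D / δ)
  have hπ := Real.pi_pos
  have hlim : Tendsto (fun h : ℝ => (δ * h)⁻¹) atTop (𝓝 0) :=
    tendsto_inv_atTop_zero.comp (tendsto_id.const_mul_atTop hδ)
  filter_upwards [hlim.eventually (gt_mem_nhds hp₀),
    hlim.eventually (gt_mem_nhds (rawPval_pos m)), eventually_ge_atTop 1]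
    with h h1 h2 h3 x y hxy hx hy ⟨h4, h5, h6⟩
  have hδh : 0 < δ * h := by positivity
  have h7 := rawPval_le_inv_of_le_cauchyVariate hy hδh h6
  have h8 : |m| ≤ |y| := abs_le_of_rawPval_le (h7.trans h2.le)
  have h9 : |y| ≤ |x| := abs_le_of_rawPval_le h4
  -- Up to sign `x` is `y - m`. As `|m| ≤ |y| ≤ |x|`, the shift cannot reduce the absolute value, so
  -- it adds to it in full.
  have h10 : |y| + |m| ≤ |x| := by
    rcases hxy with rfl | rfl <;>
    · revert h8 h9
      rcases abs_cases x with ⟨e1, _⟩ | ⟨e1, _⟩ <;> rcases abs_cases m with ⟨e2, _⟩ | ⟨e2, _⟩ <;>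
      rcases lt_or_gt_of_ne hm with hm' | hm' <;>
      first
      | rcases abs_cases (x + m) with ⟨e3, _⟩ | ⟨e3, _⟩ <;> rw [e1, e2, e3] <;> intros <;> linarith
      | rcases abs_cases (-x + m) with ⟨e3, _⟩ | ⟨e3, _⟩ <;> rw [e1, e2, e3] <;> intros <;> linarith
  have h11 := hlt x y h10 (h7.trans h1.le)
  have h12 : cauchyPval (D * h) ≤ rawPval x := by
    by_contra! hc
    exact absurd ((lt_cauchyVariate_iff hx).2 hc) (not_lt.2 h5)
  have h13 := (le_cauchyPval (by nlinarith : 1 ≤ D * h)).trans h12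
  have h14 : rawPval y ≤ (Real.pi * (δ * h))⁻¹ :=
    ((le_cauchyVariate_iff hy).1 h6).trans (cauchyPval_le_inv hδh)
  have h15 : (Real.pi * (δ * h))⁻¹ = 2 * D / δ * (2 * Real.pi * (D * h))⁻¹ := by
    field_simp
  have h16 : 2 * D / δ * (2 * Real.pi * (D * h))⁻¹ ≤ 2 * D / δ * rawPval x := by gcongr
  linarith

variable [IsProbabilityMeasure P]

lemma PairwiseNormal.eventually_measureReal_pair_le (hX : PairwiseNormal P X F) {k j : Fin d}
    (hk : k ∉ F) (hkj : ¬ SamePval P X k j) {δ c : ℝ} (hδ : 0 < δ) (hc : 0 < c) :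
    ∀ᶠ h : ℝ in atTop, P.real {ω | pvals X ω k ≤ pvals X ω j ∧
      cauchyVariate (pvals X ω k) ≤ d * h ∧ δ * h ≤ cauchyVariate (pvals X ω j)} ≤ c / h := by
  have hne : k ≠ j := by
    rintro rfl
    exact hkj ((samePval_equivalence P X).refl k)
  have hpair := hX.normalPair hk hne
  have hr := abs_covariance_le_one hpair
  rcases hr.lt_or_eq with hr1 | hr1
  · set r := |covariance (X k) (X j) P| with hrdef
    have hr0 : 0 ≤ r := abs_nonneg _
    -- Any exponent strictly between `1` and `2 / (1 + r)` would do; this is their midpoint.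
    have hβ : 1 < 1 / 2 + (1 + r)⁻¹ := by
      have : (2 : ℝ)⁻¹ < (1 + r)⁻¹ := inv_strictAnti₀ (by positivity) (by linarith)
      linarith
    have hβr : (1 / 2 + (1 + r)⁻¹) * (1 + r) < 2 := by
      rw [add_mul, inv_mul_cancel₀ (by positivity)]
      linarith
    set β := 1 / 2 + (1 + r)⁻¹
    obtain ⟨C, hC, hbound⟩ := exists_joint_tail hr0 (by linarith) hβr |∫ ω, X j ω ∂P|
    filter_upwards [eventually_mul_rpow_le (C := C * δ ^ (-β)) hβ hc, eventually_gt_atTop 0]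
      with h h1 h2
    refine le_trans ?_ h1
    have hδh : 0 < δ * h := by positivity
    refine le_trans ?_ ((hbound Ω P (X k) (X j) _ hpair le_rfl le_rfl (δ * h)⁻¹
      (by positivity)).trans_eq ?_)
    · refine ENNReal.toReal_mono (measure_ne_top _ _) (measure_mono_ae ?_)
      filter_upwards [hX.ae_pvals_mem] with ω hω
      rintro ⟨h3, -, h5⟩
      have := rawPval_le_inv_of_le_cauchyVariate (hω j) hδh h5
      exact ⟨le_trans h3 this, this⟩
    · rw [Real.inv_rpow hδh.le, ← Real.rpow_neg hδh.le, Real.mul_rpow hδ.le h2.le, mul_assoc]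
  -- At correlation `± 1` a zero mean would make the two `p`-values agree almost surely, so a
  -- nonzero shift remains.
  · have hm : ∫ ω, X j ω ∂P ≠ 0 := by
      intro hm
      refine hkj ?_
      rw [hm] at hpair
      rcases hpair.ae_eq_of_abs_covariance_eq_one hr1 with h | h <;>
      · filter_upwards [h] with ω hω
        simp [pvals, rawPval, hω]
    have hd : (1 : ℝ) ≤ d := by exact_mod_cast (Nat.zero_le _).trans_lt k.2
    filter_upwards [eventually_not_of_shift hm hδ hd, eventually_gt_atTop 0] with h h1 h2
    have h0 : P.real {ω | pvals X ω k ≤ pvals X ω j ∧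
        cauchyVariate (pvals X ω k) ≤ d * h ∧ δ * h ≤ cauchyVariate (pvals X ω j)} = 0 := by
      rw [measureReal_eq_zero_iff, measure_eq_zero_iff_ae_notMem]
      have hxy : ∀ᵐ ω ∂P, X j ω = X k ω + ∫ ω, X j ω ∂P ∨ X j ω = -X k ω + ∫ ω, X j ω ∂P := by
        rcases hpair.ae_eq_of_abs_covariance_eq_one hr1 with h | h
        · exact h.mono fun _ => Or.inl
        · exact h.mono fun _ => Or.inr
      filter_upwards [hX.ae_pvals_mem, hxy] with ω hω hω'
      exact h1 _ _ hω' (hω k) (hω j)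
    rw [h0]
    positivity

lemma PairwiseNormal.eventually_residual_le (hX : PairwiseNormal P X F) {δ c : ℝ} (hδ : 0 < δ)
    (hc : 0 < c) :
    ∀ᶠ h : ℝ in atTop,
      P.real {ω | Residual (pvals X ω) F (SamePval P X) δ h} ≤ c / h := by
  classical
  set I : Finset (Fin d × Fin d) := Finset.univ.filter fun q => q.1 ∉ F ∧ ¬ SamePval P X q.1 q.2
  have hpairs : ∀ᶠ h : ℝ in atTop, ∀ q ∈ I, P.real {ω | pvals X ω q.1 ≤ pvals X ω q.2 ∧
      cauchyVariate (pvals X ω q.1) ≤ d * h ∧ δ * h ≤ cauchyVariate (pvals X ω q.2)} ≤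
      c / (I.card + 1) / h := by
    rw [Filter.eventually_all_finset]
    intro q hq
    have := (Finset.mem_filter.1 hq).2
    exact hX.eventually_measureReal_pair_le this.1 this.2 hδ (by positivity)
  filter_upwards [hpairs, eventually_gt_atTop 0] with h h1 h2
  have hsub : {ω | Residual (pvals X ω) F (SamePval P X) δ h} ⊆ ⋃ q ∈ I,
      {ω | pvals X ω q.1 ≤ pvals X ω q.2 ∧
        cauchyVariate (pvals X ω q.1) ≤ d * h ∧ δ * h ≤ cauchyVariate (pvals X ω q.2)} := by
    rintro ω ⟨S, k, hkF, hS, hle, hsum⟩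
    have hd : 0 < (d : ℝ) := by exact_mod_cast (Nat.zero_le _).trans_lt k.2
    obtain ⟨j, hj, hj'⟩ := exists_div_le_of_le_sum (K := d) (by positivity)
      (by exact_mod_cast (Finset.card_le_univ S).trans_eq (Fintype.card_fin d)) hsum
    have h3 : δ * (d * h) / d = δ * h := by field_simp
    rw [h3] at hj'
    exact Set.mem_iUnion₂.2 ⟨(k, j), Finset.mem_filter.2 ⟨Finset.mem_univ _, hkF, (hS j hj).2⟩,
      (hS j hj).1, hle, hj'⟩
  refine (measureReal_mono hsub (measure_ne_top _ _)).trans ((measureReal_biUnion_finset_le _ _).trans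
    ((Finset.sum_le_sum h1).trans ?_))
  rw [Finset.sum_const, nsmul_eq_mul, ← mul_div_assoc, ← mul_div_assoc]
  gcongr
  rw [div_le_iff₀ (by positivity)]
  nlinarith

end SCC

namespace SCC

/-! ### Weakly correlated statistics -/

/-- Rayleigh bound: a real symmetric matrix with eigenvalues at most `C` has quadratic form at
most `C` times the squared norm. -/
lemma dotProduct_mulVec_le_of_eigenvalue_le {n : Type*} [Fintype n] [DecidableEq n]
    {A : Matrix n n ℝ} (hA : A.IsHermitian) {C : ℝ}
    (hC : ∀ lam : ℝ, Module.End.HasEigenvalue (Matrix.toLin' A) lam → lam ≤ C) (v : n → ℝ) :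
    v ⬝ᵥ A.mulVec v ≤ C * (v ⬝ᵥ v) := by
  have hB : (C • (1 : Matrix n n ℝ) - A).IsHermitian := by
    refine Matrix.IsHermitian.sub ?_ hA
    ext i j
    simp [Matrix.one_apply, eq_comm]
  have hpsd : (C • (1 : Matrix n n ℝ) - A).PosSemidef := by
    rw [hB.posSemidef_iff_eigenvalues_nonneg]
    intro i
    have h1 := hB.mulVec_eigenvectorBasis i
    have hne : (hB.eigenvectorBasis i).ofLp ≠ 0 := by
      intro h0
      have := hB.eigenvectorBasis.orthonormal.ne_zero i
      exact this (by ext j; simpa using congrFun h0 j)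
    -- Eigenvectors of `C • 1 - A` are eigenvectors of `A`, so `hC` makes the eigenvalues of the
    -- difference nonnegative.
    have h2 : Module.End.HasEigenvalue (Matrix.toLin' A) (C - hB.eigenvalues i) := by
      refine Module.End.hasEigenvalue_of_hasEigenvector
        (x := (hB.eigenvectorBasis i).ofLp) ⟨?_, hne⟩
      rw [Module.End.mem_eigenspace_iff, Matrix.toLin'_apply]
      rw [Matrix.sub_mulVec, Matrix.smul_mulVec, Matrix.one_mulVec] at h1
      rw [sub_smul, ← h1]
      abel
    have := hC _ h2
    simp only [Pi.zero_apply]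
    linarith
  have h := hpsd.dotProduct_mulVec_nonneg v
  rw [Matrix.sub_mulVec, Matrix.smul_mulVec, Matrix.one_mulVec, dotProduct_sub,
    dotProduct_smul, smul_eq_mul] at h
  simp only [star_trivial] at h
  linarith

variable {d : ℕ} {Ω : Type*} [MeasurableSpace Ω] {P : Measure Ω}
  {X : Fin d → Ω → ℝ} {F : Finset (Fin d)}

lemma PairwiseNormal.corrMatrix_apply (hX : PairwiseNormal P X F) (i j : Fin d) :
    corrMatrix P X i j = covariance (X i) (X j) P := by
  simp [corrMatrix, variance_of_hasLaw_gaussianReal (hX.standardized _)]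

lemma WeakCorrelation.abs_covariance_le (hX : PairwiseNormal P X F) {C₀ σsq : ℝ}
    (hw : WeakCorrelation P X C₀ σsq) {i j : Fin d} (hij : i ≠ j) :
    |covariance (X i) (X j) P| ≤ √σsq := by
  rw [← Real.sqrt_sq_eq_abs]
  refine Real.sqrt_le_sqrt ?_
  rcases lt_or_gt_of_ne hij with h | h
  · rw [← hX.corrMatrix_apply]
    exact hw.corr_sq_le i j h
  · rw [covariance_comm, ← hX.corrMatrix_apply]
    exact hw.corr_sq_le j i h

lemma PairwiseNormal.memLp_two (hX : PairwiseNormal P X F) (i : Fin d) : MemLp (X i) 2 P :=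
  (hX.standardized i).hasGaussianLaw.memLp_two

variable [IsProbabilityMeasure P]

/-- A bound on the eigenvalues of the correlation matrix bounds the rows of the matrix. -/
lemma WeakCorrelation.sum_sq_covariance_le (hX : PairwiseNormal P X F) {C₀ σsq : ℝ} (hC : 0 < C₀)
    (hw : WeakCorrelation P X C₀ σsq) (k : Fin d) :
    ∑ j, covariance (X k) (X j) P ^ 2 ≤ C₀ := by
  -- With `v` the row `k` of `Σ`, `Var (∑ v_j X_j - C₀ X_k) ≥ 0` reads `vᵀ Σ v - 2 C₀ |v|² + C₀² ≥
  -- 0`. Together with `vᵀ Σ v ≤ C₀ |v|²` this gives `|v|² ≤ C₀`.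
  set v : Fin d → ℝ := fun j => covariance (X k) (X j) P with hv
  have hherm : (corrMatrix P X).IsHermitian := by
    ext i j
    simp [hX.corrMatrix_apply, covariance_comm (X i)]
  have hray := dotProduct_mulVec_le_of_eigenvalue_le hherm hw.eigenvalue_le v
  have hmem : ∀ j, MemLp (fun ω => v j * X j ω) 2 P := fun j => (hX.memLp_two j).const_mul _
  have hZ : MemLp (fun ω => ∑ j, v j * X j ω) 2 P := memLp_finsetSum _ fun j _ => hmem j
  have hk : MemLp (fun ω => C₀ * X k ω) 2 P := (hX.memLp_two k).const_mul _
  have hvar : variance (fun ω => ∑ j, v j * X j ω) P = v ⬝ᵥ (corrMatrix P X).mulVec v := by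
    rw [variance_fun_sum hmem]
    simp only [dotProduct, Matrix.mulVec, Finset.mul_sum, covariance_const_mul_left,
      covariance_const_mul_right, hX.corrMatrix_apply]
    exact Finset.sum_congr rfl fun i _ => Finset.sum_congr rfl fun j _ => by ring
  have hcov : covariance (fun ω => ∑ j, v j * X j ω) (fun ω => C₀ * X k ω) P =
      C₀ * (v ⬝ᵥ v) := by
    rw [covariance_fun_sum_left hmem hk]
    simp only [dotProduct, Finset.mul_sum, covariance_const_mul_left, covariance_const_mul_right]
    exact Finset.sum_congr rfl fun i _ => by rw [covariance_comm (X i)]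
  have h0 := variance_nonneg (fun ω => (∑ j, v j * X j ω) - C₀ * X k ω) P
  rw [variance_fun_sub hZ hk, hvar, hcov, variance_const_mul,
    variance_of_hasLaw_gaussianReal (hX.standardized k)] at h0
  have hs : ∑ j, covariance (X k) (X j) P ^ 2 = v ⬝ᵥ v := by
    simp [dotProduct, hv, sq]
  rw [hs]
  push_cast at h0
  nlinarith

open Classical in
lemma WeakCorrelation.card_le (hX : PairwiseNormal P X F) {C₀ σsq γ : ℝ} (hC : 0 < C₀)
    (hw : WeakCorrelation P X C₀ σsq) (hγ : 0 < γ) (k : Fin d) :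
    ((Finset.univ.filter fun j => γ < |covariance (X k) (X j) P|).card : ℝ) ≤ C₀ / γ ^ 2 := by
  rw [le_div_iff₀ (by positivity), ← nsmul_eq_mul]
  refine le_trans ?_ (hw.sum_sq_covariance_le hX hC k)
  refine (Finset.card_nsmul_le_sum _ (fun j => covariance (X k) (X j) P ^ 2) _
    fun j hj => ?_).trans (Finset.sum_le_sum_of_subset_of_nonneg (Finset.subset_univ _)
      fun j _ _ => sq_nonneg _)
  rw [← sq_abs (covariance _ _ _)]
  exact pow_le_pow_left₀ hγ.le (Finset.mem_filter.1 hj).2.le 2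

/-- Bound for the residual event from bounds for the joint tails: pairs with correlation above
`γ` are few, and for these one of the variates is of order `d h`. -/
lemma WeakCorrelation.measureReal_residual_le (hX : PairwiseNormal P X F) {C₀ σsq γ δ h : ℝ}
    (hC : 0 < C₀) (hw : WeakCorrelation P X C₀ σsq) (hγ : 0 < γ) (hδ : 0 < δ) (hh : 0 < h)
    {b₁ b₂ : ℝ}
    (hb₁ : ∀ k ∉ F, ∀ j, k ≠ j →
      P.real {ω | pvals X ω k ≤ (δ * (d * h) / 2 / (C₀ / γ ^ 2))⁻¹ ∧
        pvals X ω j ≤ (δ * (d * h) / 2 / (C₀ / γ ^ 2))⁻¹} ≤ b₁)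
    (hb₂ : ∀ k ∉ F, ∀ j, k ≠ j → |covariance (X k) (X j) P| ≤ γ →
      P.real {ω | pvals X ω k ≤ (δ * h / 2)⁻¹ ∧ pvals X ω j ≤ (δ * h / 2)⁻¹} ≤ b₂)
    (hb₁0 : 0 ≤ b₁) (hb₂0 : 0 ≤ b₂) :
    P.real {ω | Residual (pvals X ω) F (SamePval P X) δ h} ≤
      d * (C₀ / γ ^ 2) * b₁ + d * d * b₂ := by
  classical
  set strong : Fin d → Finset (Fin d) := fun k =>
    (Finset.univ.filter fun j => γ < |covariance (X k) (X j) P|).filter fun j => k ≠ j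
  set weak : Fin d → Finset (Fin d) := fun k =>
    (Finset.univ.filter fun j => ¬ γ < |covariance (X k) (X j) P|).filter fun j => k ≠ j
  set t₁ := δ * (d * h) / 2 / (C₀ / γ ^ 2)
  set t₂ := δ * h / 2
  set E : ℝ → Fin d → Fin d → Set Ω := fun t k j => {ω | pvals X ω k ≤ t⁻¹ ∧ pvals X ω j ≤ t⁻¹}
  have hsub : P.real {ω | Residual (pvals X ω) F (SamePval P X) δ h} ≤
      P.real ((⋃ k ∈ Fᶜ, ⋃ j ∈ strong k, E t₁ k j) ∪ ⋃ k ∈ Fᶜ, ⋃ j ∈ weak k, E t₂ k j) := by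
    refine ENNReal.toReal_mono (measure_ne_top _ _) (measure_mono_ae ?_)
    filter_upwards [hX.ae_pvals_mem] with ω hω
    rintro ⟨S, k, hkF, hS, -, hsum⟩
    have hd : 0 < (d : ℝ) := by exact_mod_cast (Nat.zero_le _).trans_lt k.2
    have hne : ∀ j ∈ S, k ≠ j := by
      rintro j hj rfl
      exact (hS k hj).2 ((samePval_equivalence P X).refl k)
    have hconc : ∀ t : ℝ, 0 < t → ∀ j ∈ S, t ≤ cauchyVariate (pvals X ω j) → ω ∈ E t k j := by
      intro t ht j hj hle
      have := rawPval_le_inv_of_le_cauchyVariate (hω j) ht hle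
      exact ⟨(hS j hj).1.trans this, this⟩
    -- One of the two parts carries half of the sum. Averaging over at most `C₀ / γ²` strong
    -- partners yields a variate of order `d h`, over at most `d` weak ones a variate of order `h`.
    rw [← Finset.sum_filter_add_sum_filter_not S fun j => γ < |covariance (X k) (X j) P|] at hsum
    rcases le_or_gt (δ * (d * h) / 2) (∑ j ∈ S with γ < |covariance (X k) (X j) P|,
      cauchyVariate (pvals X ω j)) with hs | hs
    · left
      have hcard := Finset.card_le_card (Finset.filter_subset_filter
        (fun j => γ < |covariance (X k) (X j) P|) (Finset.subset_univ S))
      obtain ⟨j, hj, hle⟩ := exists_div_le_of_le_sum (K := C₀ / γ ^ 2) (by positivity)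
        ((Nat.cast_le.2 hcard).trans (hw.card_le hX hC hγ k)) hs
      rw [Finset.mem_filter] at hj
      exact Set.mem_iUnion₂.2 ⟨k, Finset.mem_compl.2 hkF, Set.mem_iUnion₂.2 ⟨j,
        Finset.mem_filter.2 ⟨Finset.mem_filter.2 ⟨Finset.mem_univ _, hj.2⟩, hne j hj.1⟩,
        hconc t₁ (by positivity) j hj.1 hle⟩⟩
    · right
      obtain ⟨j, hj, hle⟩ := exists_div_le_of_le_sum (K := d) (a := δ * (d * h) / 2)
        (f := fun j => cauchyVariate (pvals X ω j))
        (S := S.filter fun j => ¬ γ < |covariance (X k) (X j) P|) (by positivity)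
        (by exact_mod_cast (Finset.card_le_univ _).trans_eq (Fintype.card_fin d))
        (by linarith)
      have h3 : δ * (d * h) / 2 / d = t₂ := by
        simp only [t₂]
        field_simp
      rw [h3] at hle
      rw [Finset.mem_filter] at hj
      exact Set.mem_iUnion₂.2 ⟨k, Finset.mem_compl.2 hkF, Set.mem_iUnion₂.2 ⟨j,
        Finset.mem_filter.2 ⟨Finset.mem_filter.2 ⟨Finset.mem_univ _, hj.2⟩, hne j hj.1⟩,
        hconc t₂ (by positivity) j hj.1 hle⟩⟩
  have hcard : ((Fᶜ.card : ℕ) : ℝ) ≤ d := by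
    exact_mod_cast (Finset.card_le_univ _).trans_eq (Fintype.card_fin d)
  have hunion : ∀ (N : Fin d → Finset (Fin d)) (t K b : ℝ), 0 ≤ b → 0 ≤ K →
      (∀ k, ((N k).card : ℝ) ≤ K) → (∀ k ∉ F, ∀ j ∈ N k, P.real (E t k j) ≤ b) →
      P.real (⋃ k ∈ Fᶜ, ⋃ j ∈ N k, E t k j) ≤ d * K * b := by
    intro N t K b hb hK hN hbound
    refine (measureReal_biUnion_finset_le _ _).trans ?_
    have h1 : ∀ k ∈ Fᶜ, P.real (⋃ j ∈ N k, E t k j) ≤ K * b := by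
      intro k hk
      refine (measureReal_biUnion_finset_le _ _).trans
        ((Finset.sum_le_sum fun j hj => hbound k (Finset.mem_compl.1 hk) j hj).trans ?_)
      rw [Finset.sum_const, nsmul_eq_mul]
      gcongr
      exact hN k
    refine (Finset.sum_le_sum h1).trans ?_
    rw [Finset.sum_const, nsmul_eq_mul, mul_assoc]
    gcongr
  refine hsub.trans ((measureReal_union_le _ _).trans (add_le_add ?_ ?_))
  · refine hunion strong t₁ _ _ hb₁0 (by positivity) (fun k => le_trans ?_ (hw.card_le hX hC hγ k))
      fun k hk j hj => hb₁ k hk j (Finset.mem_filter.1 hj).2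
    exact_mod_cast Finset.card_le_card (Finset.filter_subset _ _)
  · refine hunion weak t₂ _ _ hb₂0 (by positivity) (fun k => ?_) fun k hk j hj => ?_
    · exact_mod_cast (Finset.card_le_univ _).trans_eq (Fintype.card_fin d)
    · rw [Finset.mem_filter, Finset.mem_filter] at hj
      exact hb₂ k hk j hj.2 (not_lt.1 hj.1.2)

end SCC

/-! ### Diverging number of hypotheses: choice of the exponents -/

namespace SCC

lemma eventually_residual_le_of_weakCorrelation {d : ℕ → ℕ} {Ω : ℕ → Type*}
    [∀ n, MeasurableSpace (Ω n)] {P : ∀ n, Measure (Ω n)} [∀ n, IsProbabilityMeasure (P n)]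
    {X : ∀ n, Fin (d n) → Ω n → ℝ} {F : ∀ n, Finset (Fin (d n))} {h : ℕ → ℝ} {η C₀ σsq M : ℝ}
    (hh : Tendsto h atTop atTop) (hd : ∀ᶠ n in atTop, 1 ≤ d n) (hη : 0 < η) (hη2 : η < 1 / 2)
    (hdh : ∀ᶠ n in atTop, (d n : ℝ) ≤ h n ^ η) (hC : 0 < C₀) (hσ : σsq < 1)
    (hX : ∀ n, PairwiseNormal (P n) (X n) (F n))
    (hw : ∀ n, WeakCorrelation (P n) (X n) C₀ σsq)
    (hM : ∀ n, ∀ i ∈ F n, |∫ ω, X n i ω ∂(P n)| ≤ M) {δ c : ℝ} (hδ : 0 < δ) (hc : 0 < c) :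
    ∀ᶠ n in atTop, (P n).real {ω | Residual (pvals (X n) ω) (F n) (SamePval (P n) (X n)) δ (h n)} ≤
      c / h n := by
  have hr0 : 0 ≤ √σsq := Real.sqrt_nonneg _
  have hr1 : √σsq < 1 := by
    rw [Real.sqrt_lt' one_pos]
    linarith
  set β₁ : ℝ := 1 / 2 + (1 + √σsq)⁻¹ with hβ₁
  have hβ₁1 : 1 < β₁ := by
    have : (2 : ℝ)⁻¹ < (1 + √σsq)⁻¹ := inv_strictAnti₀ (by positivity) (by linarith)
    linarith
  have hβ₁r : β₁ * (1 + √σsq) < 2 := by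
    rw [hβ₁, add_mul, inv_mul_cancel₀ (by positivity)]
    linarith
  -- Since `2 η = 1 - 4 γ`, the exponent `β₂ = 2 - 3 γ` satisfies `β₂ - 2 η = 1 + γ > 1`, and `β₂ (1
  -- + γ) = 2 - γ - 3 γ² < 2` makes it admissible for correlations up to `γ`.
  set γ : ℝ := (1 - 2 * η) / 4 with hγdef
  have hγ : 0 < γ := by linarith
  set β₂ : ℝ := 2 - 3 * γ with hβ₂
  have hβ₂1 : 1 < β₂ - 2 * η := by linarith
  have hβ₂r : β₂ * (1 + γ) < 2 := by nlinarith
  obtain ⟨C₁, hC₁, htail₁⟩ := exists_joint_tail hr0 (by linarith) hβ₁r (max M 0)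
  obtain ⟨C₂, hC₂, htail₂⟩ := exists_joint_tail hγ.le (by linarith) hβ₂r (max M 0)
  have hmean : ∀ n i, |∫ ω, X n i ω ∂(P n)| ≤ max M 0 := by
    intro n i
    by_cases hi : i ∈ F n
    · exact le_max_of_le_left (hM n i hi)
    · rw [(hX n).mean_zero i hi, abs_zero]
      exact le_max_right _ _
  have hK : 0 < C₀ / γ ^ 2 := by positivity
  set K : ℝ := C₀ / γ ^ 2
  have hτ : 0 < δ / 2 / K := by positivity
  set τ : ℝ := δ / 2 / K
  filter_upwards [hd, hdh, hh.eventually (eventually_gt_atTop 0),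
    hh.eventually (eventually_mul_rpow_le (C := K * C₁ * τ ^ (-β₁)) hβ₁1 (half_pos hc)),
    hh.eventually (eventually_mul_rpow_le (C := C₂ * (δ / 2) ^ (-β₂)) hβ₂1 (half_pos hc))]
    with n hd hdh hh h₁ h₂
  have hd1 : (1 : ℝ) ≤ d n := by exact_mod_cast hd
  have hd0 : (0 : ℝ) < d n := by linarith
  have ht₁ : 0 < δ * (d n * h n) / 2 / K := by positivity
  have ht₂ : 0 < δ * h n / 2 := by positivity
  refine ((hw n).measureReal_residual_le (hX n) hC hγ hδ hh
    (b₁ := C₁ * (δ * (d n * h n) / 2 / K)⁻¹ ^ β₁) (b₂ := C₂ * (δ * h n / 2)⁻¹ ^ β₂)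
    (fun k hk j hkj => htail₁ _ _ _ _ _ ((hX n).normalPair hk hkj) (hmean n j)
      ((hw n).abs_covariance_le (hX n) hkj) _ (by positivity))
    (fun k hk j hkj hcov => htail₂ _ _ _ _ _ ((hX n).normalPair hk hkj) (hmean n j) hcov _
      (by positivity)) (by positivity) (by positivity)).trans ?_
  -- The factor `d` from the number of strong pairs is cancelled by `d ^ (-β₁)`, so this part needs
  -- no growth condition on `d`.
  have e₁ : d n * K * (C₁ * (δ * (d n * h n) / 2 / K)⁻¹ ^ β₁) ≤
      K * C₁ * τ ^ (-β₁) * h n ^ (-β₁) := by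
    have : δ * (d n * h n) / 2 / K = d n * (τ * h n) := by
      simp only [τ]
      ring
    rw [this, Real.inv_rpow (by positivity), ← Real.rpow_neg (by positivity),
      Real.mul_rpow hd0.le (by positivity), Real.mul_rpow hτ.le hh.le]
    have hdβ : d n * (d n : ℝ) ^ (-β₁) ≤ 1 := by
      have := Real.rpow_le_rpow_of_exponent_le hd1 (by linarith : -β₁ ≤ -1)
      rw [Real.rpow_neg_one] at this
      calc d n * (d n : ℝ) ^ (-β₁) ≤ d n * (d n : ℝ)⁻¹ := by gcongr
        _ = 1 := mul_inv_cancel₀ hd0.ne'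
    calc _ = (d n * (d n : ℝ) ^ (-β₁)) * (K * C₁ * τ ^ (-β₁) * h n ^ (-β₁)) := by ring
      _ ≤ 1 * (K * C₁ * τ ^ (-β₁) * h n ^ (-β₁)) := by gcongr
      _ = _ := one_mul _
  have e₂ : d n * d n * (C₂ * (δ * h n / 2)⁻¹ ^ β₂) ≤
      C₂ * (δ / 2) ^ (-β₂) * h n ^ (-(β₂ - 2 * η)) := by
    have : δ * h n / 2 = δ / 2 * h n := by ring
    rw [this, Real.inv_rpow (by positivity), ← Real.rpow_neg (by positivity),
      Real.mul_rpow (by positivity) hh.le]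
    have hexp : h n ^ (-(β₂ - 2 * η)) = h n ^ η * h n ^ η * h n ^ (-β₂) := by
      rw [← Real.rpow_add hh, ← Real.rpow_add hh]
      ring_nf
    rw [hexp]
    calc _ ≤ h n ^ η * h n ^ η * (C₂ * ((δ / 2) ^ (-β₂) * h n ^ (-β₂))) := by gcongr
      _ = _ := by ring
  have : c / h n = c / 2 / h n + c / 2 / h n := by ring
  linarith

end SCC

theorem theorem1 :
    -- fixed number of hypotheses
    (∀ (d : ℕ) (Ω : Type*) [MeasurableSpace Ω] (P : Measure Ω) [IsProbabilityMeasure P]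
      (X : Fin d → Ω → ℝ) (F : Finset (Fin d)),
      SCC.PairwiseNormal P X F →
        (∀ α : ℝ, SCC.Monotonicity P X α) ∧
        ∀ ε : ℝ, 0 < ε → ∀ᶠ α in 𝓝[>] (0 : ℝ), SCC.ErrorBounds P X F α ε) ∧
    -- diverging number of hypotheses
    (∀ (d : ℕ → ℕ) (Ω : ℕ → Type*) [∀ n, MeasurableSpace (Ω n)] (P : ∀ n, Measure (Ω n))
      [∀ n, IsProbabilityMeasure (P n)] (X : ∀ n, Fin (d n) → Ω n → ℝ)
      (F : ∀ n, Finset (Fin (d n))) (α : ℕ → ℝ) (η C₀ σsq M : ℝ),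
      Tendsto α atTop (𝓝[>] (0 : ℝ)) →
      Tendsto d atTop atTop →
      0 < η → η < 1 / 2 →
      (fun n => (d n : ℝ)) =o[atTop] (fun n => Real.tan ((1 / 2 - α n) * Real.pi) ^ η) →
      0 < C₀ → 0 < σsq → σsq < 1 →
      (∀ n, SCC.PairwiseNormal (P n) (X n) (F n)) →
      (∀ n, SCC.WeakCorrelation (P n) (X n) C₀ σsq) →
      -- the means of the false hypotheses are bounded; those of the true ones vanish
      (∀ n, ∀ i ∈ F n, |∫ ω, X n i ω ∂(P n)| ≤ M) →
        (∀ n, ∀ a : ℝ, SCC.Monotonicity (P n) (X n) a) ∧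
        ∀ ε : ℝ, 0 < ε → ∀ᶠ n in atTop, SCC.ErrorBounds (P n) (X n) (F n) (α n) ε) := by
  refine ⟨?_, ?_⟩
  · intro d Ω _ P _ X F hX
    refine ⟨hX.monotonicity, fun ε hε => ?_⟩
    -- The fixed law is treated as a constant family indexed by the level `α` itself.
    exact SCC.eventually_errorBounds (P := fun _ : ℝ => P) (X := fun _ => X) (F := fun _ => F)
      tendsto_id (fun _ => hX)
      (fun δ c hδ hc => SCC.tendsto_cauchyVariate.eventually (hX.eventually_residual_le hδ hc)) hε
  · intro d Ω _ P _ X F α η C₀ σsq M hα hd hη hη2 hdo hC _ hσ hX hw hM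
    refine ⟨fun n => (hX n).monotonicity, fun ε hε => ?_⟩
    have hh : Tendsto (fun n => SCC.cauchyVariate (α n)) atTop atTop :=
      SCC.tendsto_cauchyVariate.comp hα
    have hdh : ∀ᶠ n in atTop, (d n : ℝ) ≤ SCC.cauchyVariate (α n) ^ η := by
      filter_upwards [hdo.bound one_pos, hh.eventually (eventually_gt_atTop 0)] with n h1 h2
      have h3 : 0 ≤ SCC.cauchyVariate (α n) ^ η := by positivity
      change ‖(d n : ℝ)‖ ≤ 1 * ‖SCC.cauchyVariate (α n) ^ η‖ at h1
      rwa [one_mul, Real.norm_of_nonneg h3, Real.norm_of_nonneg (Nat.cast_nonneg _)] at h1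
    exact SCC.eventually_errorBounds hα hX (fun δ c hδ hc =>
      SCC.eventually_residual_le_of_weakCorrelation hh (hd.eventually (eventually_ge_atTop 1))
        hη hη2 hdh hC hσ hX hw hM hδ hc) hε
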